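/- Let $\mathbb F$ be a division ring, $\sigma$ an automorphism of $\mathbb F$, and $\delta$ a $\sigma$-derivation of $\mathbb F$ (an additive map with $\delta(ab)=\sigma(a)\delta(b)+\delta(a)b$). Let $\mathcal R=\mathbb F[x;\sigma,\delta]$ be the skew polynomial ring, whose elements are the polynomials $\sum_i a_ix^i$ with $a_i\in\mathbb F$, with the usual addition and the product determined by $xa=\sigma(a)x+\delta(a)$. **Notation.** Let $a\in\mathbb F$ and $f\in\mathcal R$. * The right evaluation $f(a)$ (left evaluation $f_L(a)$) is the remainder of the right (left) division of $f$ by $x-a$: $f=q(x-a)+f(a)$ (respectively $f=(x-a)q+f_L(a)$). The element $a$ is a right (left) root of $f$ if $f(a)=0$ ($f_L(a)=0$). It is a right (left) root of multiplicity $\ge r$ if $(x-a)^r$ divides $f$ on the right (left), i.e. $f=q(x-a)^r$ (respectively $f=(x-a)^rq$) for some $q\in\mathcal R$. * $\Delta_a^0f=\Delta_{a,L}^0f=f$, and for $j\ge1$, $\Delta_a^jf$ ($\Delta_{a,L}^jf$) is the quotient of the right (left) division of $f$ by $(x-a)^j$. * $\mathrm{gcrd}$ and $\mathrm{gcld}$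 denote the monic greatest common right and left divisors. * $\mathcal C_{d,s}(b)$ is the sum of all compositions of $d$ copies of $\delta$ and $s$ copies of $\sigma$, evaluated at $b$; $\mathcal T_{d,s}(b)$ is the sum of all compositions of $d$ copies of $\delta\sigma^{-1}$ and $s$ copies of $\sigma^{-1}$, evaluated at $b$. * Let $f=\sum_{i=0}^m a_ix^i=\sum_{i=0}^m x^iA_i$ with $A_i=\sum_{j=0}^{m-i}(-1)^j\mathcal T_{j,i}(a_{j+i})$, and $g=\sum_{i=0}^n b_ix^i=\sum_{i=0}^n x^iB_i$, have degrees $m$ and $n$. All coefficients with index outside the range are $0$. * The right Sylvester matrix of $f,g$ is the $(m+n)\times(m+n)$ matrix $A$ whose row $k$, $0\le k<n$, has the entries $\sum_{i=0}^k\mathcal C_{k-i,i}(a_{l-i})$, $0\le l<m+n$, and whose row $n+k$, $0\le k<m$, has the entries $\sum_{i=0}^k\mathcal C_{k-i,i}(b_{l-i})$. It is the matrix of the system $(c_0,\dots,c_{n-1},d_0,\dots,d_{m-1})A=0$ that expresses $cf+dg=0$ for $c=\sum_{i<n} c_ix^i$, $d=\sum_{i<m} d_ix^i$. * The left Sylvester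 matrix of $f,g$ is the $(m+n)\times(m+n)$ matrix $M$ whose column $k$, $0\le k<n$, has the entries $\sum_{i=0}^k(-1)^{k+i}\mathcal T_{k-i,i}(A_{l-i})$, $0\le l<m+n$, and whose column $n+k$, $0\le k<m$, has the entries $\sum_{i=0}^k(-1)^{k+i}\mathcal T_{k-i,i}(B_{l-i})$. It is the matrix of the system $M(C_0,\dots,C_{n-1},D_0,\dots,D_{m-1})^T=0$ that expresses $fc+gd=0$ for $c=\sum_{i<n} x^iC_i$, $d=\sum_{i<m} x^iD_i$. * The right resultant $R^{\sigma,\delta}_{\mathbb F}(f,g)$ and the left resultant $R^{\sigma,\delta}_{\mathbb F,L}(f,g)$ are the Dieudonné determinants, with values in $\{0\}\cup\mathbb F^*/[\mathbb F^*,\mathbb F^*]$, of $A$ and of $M$. **Theorem.** Let $f\in\mathcal R$, $a\in\mathbb F$, and let $r$ be a positive integer with $r<\deg f$. (I) The following are equivalent: 1. $a$ is a right root of $f$ of multiplicity $\ge r$; 2. $a$ is a common right root of $f,\Delta_a^1f,\dots,\Delta_a^{r-1}f$; 3. $R^{\sigma,\delta}_{\mathbb F,L}(\Delta_a^jf,\Delta_a^{j+1}f)=0$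 for $j=0,\dots,r-1$; 4. $\mathrm{gcld}(\Delta_a^jf,\Delta_a^{j+1}f)\ne1$ for $j=0,\dots,r-1$. (II) The following are equivalent: 1. $a$ is a left root of $f$ of multiplicity $\ge r$; 2. $a$ is a common left root of $f,\Delta_{a,L}^1f,\dots,\Delta_{a,L}^{r-1}f$; 3. $R^{\sigma,\delta}_{\mathbb F}(\Delta_{a,L}^jf,\Delta_{a,L}^{j+1}f)=0$ for $j=0,\dots,r-1$; 4. $\mathrm{gcrd}(\Delta_{a,L}^jf,\Delta_{a,L}^{j+1}f)\ne1$ for $j=0,\dots,r-1$. -/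

import Mathlib

noncomputable section

/-- A `σ`-derivation of the division ring `F`, for an automorphism `σ` of `F`: an additive map
`δ : F → F` with `δ (a b) = σ a * δ b + δ a * b`. -/
structure SigmaDerivation {F : Type*} [DivisionRing F] (σ : F ≃+* F) where
  toAddMonoidHom : F →+ F
  leibniz : ∀ a b : F,
    toAddMonoidHom (a * b) = σ a * toAddMonoidHom b + toAddMonoidHom a * b

instance {F : Type*} [DivisionRing F] (σ : F ≃+* F) :
    CoeFun (SigmaDerivation σ) (fun _ => F → F) :=
  ⟨fun δ => δ.toAddMonoidHom⟩

/-- The underlying set of the Ore extension `F[x; σ, δ]`: polynomials `∑ i, a_i x ^ i` with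
coefficients written on the left, given by the finitely supported sequence of the `a_i`. -/
def SkewPoly {F : Type*} [DivisionRing F] (σ : F ≃+* F) (_δ : SigmaDerivation σ) : Type _ :=
  ℕ →₀ F

namespace SkewPoly

variable {F : Type*} [DivisionRing F] {σ : F ≃+* F} {δ : SigmaDerivation σ}

/-- The usual (coefficientwise) sum of polynomials. -/
instance : AddCommGroup (SkewPoly σ δ) := inferInstanceAs (AddCommGroup (ℕ →₀ F))

/-- Left multiplication by scalars, coefficientwise. -/
instance : Module F (SkewPoly σ δ) := inferInstanceAs (Module F (ℕ →₀ F))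

/-- The monomial `a x ^ i`. -/
def monomial (i : ℕ) (a : F) : SkewPoly σ δ := Finsupp.single i a

/-- The coefficient of `x ^ i`, coefficients being written on the left. -/
def coeff (f : SkewPoly σ δ) (i : ℕ) : F := (show ℕ →₀ F from f) i

/-- The degree, with the zero polynomial of degree `⊥`. -/
def degree (f : SkewPoly σ δ) : WithBot ℕ := (show ℕ →₀ F from f).support.max

/-- The degree as a natural number, with the zero polynomial of degree `0`. -/
def natDegree (f : SkewPoly σ δ) : ℕ := f.degree.unbotD 0

/-- The leading coefficient is `1`. -/
def Monic (f : SkewPoly σ δ) : Prop := f.coeff f.natDegree = 1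

/-- Multiplication by `x` on the left, as dictated by `x b = σ b x + δ b`:
`x (∑ j, b_j x ^ j) = ∑ j, (σ b_j x ^ (j + 1) + δ b_j x ^ j)`. -/
def xMul : AddMonoid.End (SkewPoly σ δ) :=
  Finsupp.liftAddHom (M := F) (N := ℕ →₀ F) fun j =>
    (Finsupp.singleAddHom (j + 1)).comp (σ : F →+ F) +
      (Finsupp.singleAddHom j).comp δ.toAddMonoidHom

/-- Multiplication by `∑ i, a_i x ^ i` on the left: `g ↦ ∑ i, a_i • (x ^ i g)`. -/
def mulLeftHom : SkewPoly σ δ →+ AddMonoid.End (SkewPoly σ δ) :=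
  Finsupp.liftAddHom (M := F) (N := AddMonoid.End (SkewPoly σ δ)) fun i =>
    (AddMonoidHom.mulRight ((xMul : AddMonoid.End (SkewPoly σ δ)) ^ i)).comp
      (Module.toAddMonoidEnd F (SkewPoly σ δ)).toAddMonoidHom

instance : Mul (SkewPoly σ δ) := ⟨fun f g => mulLeftHom f g⟩

instance : One (SkewPoly σ δ) := ⟨monomial 0 1⟩

theorem mul_def (f g : SkewPoly σ δ) : f * g = mulLeftHom f g := rfl

theorem one_def : (1 : SkewPoly σ δ) = monomial 0 1 := rfl

theorem mulLeftHom_add (f g h : SkewPoly σ δ) :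
    mulLeftHom (f + g) h = mulLeftHom f h + mulLeftHom g h := by
  rw [map_add]; rfl

theorem mulLeftHom_zero (h : SkewPoly σ δ) : mulLeftHom 0 h = 0 := by
  rw [map_zero]; rfl

theorem induction_on {p : SkewPoly σ δ → Prop} (f : SkewPoly σ δ) (h0 : p 0)
    (hadd : ∀ f g, p f → p g → p (f + g)) (hm : ∀ i a, p (monomial i a)) : p f :=
  Finsupp.induction_linear (motive := p) f h0 hadd hm

theorem smul_monomial (a b : F) (i : ℕ) :
    a • (monomial i b : SkewPoly σ δ) = monomial i (a * b) :=
  Finsupp.smul_single' a i b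

theorem xMul_monomial (j : ℕ) (b : F) :
    xMul (monomial j b : SkewPoly σ δ) = monomial (j + 1) (σ b) + monomial j (δ b) := by
  unfold xMul monomial
  exact Finsupp.liftAddHom_apply_single _ _ _

theorem mulLeftHom_monomial (i : ℕ) (a : F) (g : SkewPoly σ δ) :
    mulLeftHom (monomial i a) g = a • (xMul ^ i : AddMonoid.End (SkewPoly σ δ)) g := by
  unfold mulLeftHom monomial
  exact DFunLike.congr_fun (Finsupp.liftAddHom_apply_single (N := AddMonoid.End (SkewPoly σ δ))
    _ i a) g

theorem monomial_add (i : ℕ) (a b : F) :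
    (monomial i (a + b) : SkewPoly σ δ) = monomial i a + monomial i b :=
  Finsupp.single_add i a b

theorem monomial_zero (i : ℕ) : (monomial i 0 : SkewPoly σ δ) = 0 :=
  Finsupp.single_zero i

theorem xMul_smul (b : F) (g : SkewPoly σ δ) :
    xMul (b • g) = σ b • xMul g + δ b • g := by
  induction g using induction_on with
  | h0 => simp
  | hadd f g hf hg => simp only [smul_add, map_add, hf, hg]; abel
  | hm i a =>
    rw [smul_monomial, xMul_monomial, xMul_monomial, smul_add, smul_monomial, smul_monomial,
      smul_monomial, δ.leibniz, map_mul, monomial_add]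
    abel

theorem xMul_mulLeftHom (f g : SkewPoly σ δ) :
    xMul (mulLeftHom f g) = mulLeftHom (xMul f) g := by
  induction f using induction_on with
  | h0 => simp
  | hadd f₁ f₂ h₁ h₂ => rw [mulLeftHom_add, map_add, map_add, mulLeftHom_add, h₁, h₂]
  | hm i a =>
    rw [mulLeftHom_monomial, xMul_smul, xMul_monomial, mulLeftHom_add,
      mulLeftHom_monomial, mulLeftHom_monomial, pow_succ']
    rfl

theorem smul_mulLeftHom (a : F) (f g : SkewPoly σ δ) :
    a • mulLeftHom f g = mulLeftHom (a • f) g := by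
  induction f using induction_on with
  | h0 => simp
  | hadd f₁ f₂ h₁ h₂ => rw [mulLeftHom_add, smul_add, smul_add, mulLeftHom_add, h₁, h₂]
  | hm i b => rw [smul_monomial, mulLeftHom_monomial, mulLeftHom_monomial, mul_smul]

theorem xMul_pow_mulLeftHom (i : ℕ) (f g : SkewPoly σ δ) :
    (xMul ^ i : AddMonoid.End (SkewPoly σ δ)) (mulLeftHom f g) =
      mulLeftHom ((xMul ^ i : AddMonoid.End (SkewPoly σ δ)) f) g := by
  induction i generalizing f with
  | zero => rfl
  | succ i ih =>
    simp only [pow_succ, AddMonoid.End.coe_mul, Function.comp_apply, xMul_mulLeftHom, ih]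

theorem mulLeftHom_mulLeftHom (f g h : SkewPoly σ δ) :
    mulLeftHom (mulLeftHom f g) h = mulLeftHom f (mulLeftHom g h) := by
  induction f using induction_on with
  | h0 => simp
  | hadd f₁ f₂ h₁ h₂ => rw [mulLeftHom_add, mulLeftHom_add, mulLeftHom_add, h₁, h₂]
  | hm i a =>
    rw [mulLeftHom_monomial, mulLeftHom_monomial, ← smul_mulLeftHom, xMul_pow_mulLeftHom]

theorem xMul_pow_one (i : ℕ) :
    (xMul ^ i : AddMonoid.End (SkewPoly σ δ)) (monomial 0 1) = monomial i 1 := by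
  induction i with
  | zero => rfl
  | succ i ih =>
    have h1 : δ 1 = 0 := by
      have := δ.leibniz 1 1
      simpa using this
    rw [pow_succ', AddMonoid.End.coe_mul, Function.comp_apply, ih, xMul_monomial, h1, map_one]
    rw [monomial_zero, add_zero]

theorem mulLeftHom_one (f : SkewPoly σ δ) : mulLeftHom f (monomial 0 1) = f := by
  induction f using induction_on with
  | h0 => simp
  | hadd f₁ f₂ h₁ h₂ => rw [mulLeftHom_add, h₁, h₂]
  | hm i a => rw [mulLeftHom_monomial, xMul_pow_one, smul_monomial, mul_one]

/-- The ring `F[x; σ, δ]`. -/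
instance : Ring (SkewPoly σ δ) where
  __ := (inferInstance : AddCommGroup (SkewPoly σ δ))
  mul_assoc := mulLeftHom_mulLeftHom
  one_mul g := by rw [mul_def, one_def, mulLeftHom_monomial, one_smul]; rfl
  mul_one := mulLeftHom_one
  left_distrib f g h := map_add (mulLeftHom f) g h
  right_distrib f g h := mulLeftHom_add f g h
  zero_mul g := mulLeftHom_zero g
  mul_zero f := map_zero (mulLeftHom f)

/-- The constant polynomial `a`. -/
def C (a : F) : SkewPoly σ δ := monomial 0 a

/-- The variable `x`. -/
def X : SkewPoly σ δ := monomial 1 1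

/-- The defining commutation rule `x a = σ(a) x + δ(a)`. -/
theorem X_mul_C (a : F) : (X : SkewPoly σ δ) * C a = C (σ a) * X + C (δ a) := by
  have h1 : δ 1 = 0 := by
    have := δ.leibniz 1 1
    simpa using this
  simp only [X, C, mul_def, mulLeftHom_monomial, pow_one, pow_zero, one_smul, xMul_monomial]
  rw [AddMonoid.End.coe_one, id, smul_monomial, mul_one]

theorem C_mul_X_pow (a : F) (i : ℕ) : C a * (X : SkewPoly σ δ) ^ i = monomial i a := by
  have key : (X : SkewPoly σ δ) ^ i = monomial i 1 := by
    induction i with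
    | zero => rfl
    | succ i ih =>
      have h1 : δ 1 = 0 := by
        have := δ.leibniz 1 1
        simpa using this
      rw [pow_succ', ih]
      simp only [X, mul_def, mulLeftHom_monomial, pow_one, one_smul, xMul_monomial, h1, map_one]
      rw [monomial_zero, add_zero]
  rw [key, C, mul_def, mulLeftHom_monomial, pow_zero, AddMonoid.End.coe_one, id, smul_monomial,
    mul_one]

/-! ### Division, evaluation, roots and derivative polynomials -/

/-- The quotient of the right division of `f` by `g`: the `q` in `f = q g + s`,
`deg s < deg g`. -/
def rightQuot (f g : SkewPoly σ δ) : SkewPoly σ δ :=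
  open Classical in
  if h : ∃ q s : SkewPoly σ δ, f = q * g + s ∧ s.degree < g.degree then h.choose else 0

/-- The remainder of the right division of `f` by `g`. -/
def rightRem (f g : SkewPoly σ δ) : SkewPoly σ δ := f - rightQuot f g * g

/-- The quotient of the left division of `f` by `g`: the `q` in `f = g q + s`,
`deg s < deg g`. -/
def leftQuot (f g : SkewPoly σ δ) : SkewPoly σ δ :=
  open Classical in
  if h : ∃ q s : SkewPoly σ δ, f = g * q + s ∧ s.degree < g.degree then h.choose else 0

/-- The remainder of the left division of `f` by `g`. -/
def leftRem (f g : SkewPoly σ δ) : SkewPoly σ δ := f - g * leftQuot f g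

/-- The right evaluation `f(a)`: the (constant) remainder of the right division of `f` by
`x - a`. -/
def rightEval (f : SkewPoly σ δ) (a : F) : F := (rightRem f (X - C a)).coeff 0

/-- The left evaluation `f_L(a)`: the (constant) remainder of the left division of `f` by
`x - a`. -/
def leftEval (f : SkewPoly σ δ) (a : F) : F := (leftRem f (X - C a)).coeff 0

/-- `a` is a right root (right zero) of `f`. -/
def IsRightRoot (f : SkewPoly σ δ) (a : F) : Prop := rightEval f a = 0

/-- `a` is a left root (left zero) of `f`. -/
def IsLeftRoot (f : SkewPoly σ δ) (a : F) : Prop := leftEval f a = 0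

/-- `d` divides `f` on the right, i.e. `d` is a right factor of `f`. -/
def RightDvd (d f : SkewPoly σ δ) : Prop := ∃ q, f = q * d

/-- `d` divides `f` on the left, i.e. `d` is a left factor of `f`. -/
def LeftDvd (d f : SkewPoly σ δ) : Prop := ∃ q, f = d * q

/-- `a` is a right root of `f` of multiplicity `≥ r`. -/
def IsRightRootOfMultGE (f : SkewPoly σ δ) (a : F) (r : ℕ) : Prop :=
  RightDvd ((X - C a) ^ r) f

/-- `a` is a left root of `f` of multiplicity `≥ r`. -/
def IsLeftRootOfMultGE (f : SkewPoly σ δ) (a : F) (r : ℕ) : Prop :=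
  LeftDvd ((X - C a) ^ r) f

/-- The right derivative polynomial `Δ_a^j f`. -/
def rightDer (a : F) : ℕ → SkewPoly σ δ → SkewPoly σ δ
  | 0, f => f
  | j + 1, f => rightQuot f ((X - C a) ^ (j + 1))

/-- The left derivative polynomial `Δ_{a,L}^j f`. -/
def leftDer (a : F) : ℕ → SkewPoly σ δ → SkewPoly σ δ
  | 0, f => f
  | j + 1, f => leftQuot f ((X - C a) ^ (j + 1))

/-! ### Greatest common divisors -/

/-- `d` is a greatest common right divisor of `f` and `g`. -/
def IsGCRD (d f g : SkewPoly σ δ) : Prop :=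
  RightDvd d f ∧ RightDvd d g ∧ ∀ e, RightDvd e f → RightDvd e g → RightDvd e d

/-- `d` is a greatest common left divisor of `f` and `g`. -/
def IsGCLD (d f g : SkewPoly σ δ) : Prop :=
  LeftDvd d f ∧ LeftDvd d g ∧ ∀ e, LeftDvd e f → LeftDvd e g → LeftDvd e d

/-- The monic greatest common right divisor of `f` and `g` (not both zero). -/
def gcrd (f g : SkewPoly σ δ) : SkewPoly σ δ :=
  open Classical in
  if h : ∃ d : SkewPoly σ δ, d.Monic ∧ IsGCRD d f g then h.choose else 0

/-- The monic greatest common left divisor of `f` and `g` (not both zero). -/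
def gcld (f g : SkewPoly σ δ) : SkewPoly σ δ :=
  open Classical in
  if h : ∃ d : SkewPoly σ δ, d.Monic ∧ IsGCLD d f g then h.choose else 0

end SkewPoly

/-! ### The Dieudonné determinant -/

/-- The Dieudonné determinant of a square matrix over a division ring, with values in
`{0} ∪ Fˣ / [Fˣ, Fˣ]`, by Gaussian elimination with left row operations. If the first column
vanishes the value is `0`. Otherwise let `i` be the first row with `A i 0 ≠ 0`; move it to the top
(sign `(-1) ^ i`), clear the first column by adding left multiples of it to the other rows, and
take the class of the pivot times the determinant of the remaining matrix. -/
def Ddet {F : Type*} [DivisionRing F] :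
    (n : ℕ) → Matrix (Fin n) (Fin n) F → WithZero (Abelianization Fˣ)
  | 0, _ => 1
  | n + 1, A =>
    open Classical in
    if h : ∃ i, A i 0 ≠ 0 then
      ((Abelianization.of ((-1 : Fˣ) ^ (Fin.find _ h : ℕ) *
          Units.mk0 (A (Fin.find _ h) 0) (Fin.find_spec h)) : Abelianization Fˣ) :
        WithZero (Abelianization Fˣ)) *
      Ddet n (Matrix.of fun k l =>
        A ((Fin.find _ h).succAbove k) l.succ -
          A ((Fin.find _ h).succAbove k) 0 * (A (Fin.find _ h) 0)⁻¹ * A (Fin.find _ h) l.succ)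
    else 0

/-! ### Sylvester matrices and resultants -/

/-- `wordSum u v d s a` is the sum of all compositions (in any order) of `d` copies of `u` and `s`
copies of `v`, evaluated at `a`; the compositions are sorted by their outermost map. -/
def wordSum {F : Type*} [AddCommMonoid F] (u v : F → F) : ℕ → ℕ → F → F
  | 0, 0, a => a
  | d + 1, 0, a => u (wordSum u v d 0 a)
  | 0, s + 1, a => v (wordSum u v 0 s a)
  | d + 1, s + 1, a => u (wordSum u v d (s + 1) a) + v (wordSum u v (d + 1) s a)
termination_by d s => d + s

namespace SkewPoly

variable {F : Type*} [DivisionRing F] {σ : F ≃+* F} {δ : SigmaDerivation σ}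

/-- `𝒞_{d,s}(a)`: all compositions of `d` copies of `δ` and `s` copies of `σ`. -/
def wordC (σ : F ≃+* F) (δ : SigmaDerivation σ) (d s : ℕ) (a : F) : F :=
  wordSum (fun b => δ b) (fun b => σ b) d s a

/-- `𝒯_{t,r}(a)`: all compositions of `t` copies of `δ σ⁻¹` and `r` copies of `σ⁻¹`. -/
def wordT (σ : F ≃+* F) (δ : SigmaDerivation σ) (t r : ℕ) (a : F) : F :=
  wordSum (fun b => δ (σ.symm b)) (fun b => σ.symm b) t r a

/-- The coefficients `A_i` of `f = ∑ i, x ^ i A_i` when they are written on the right: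
`A_i = ∑_{j = 0}^{m - i} (-1) ^ j 𝒯_{j,i}(a_{j+i})`, where `f = ∑_{i ≤ m} a_i x ^ i`. -/
def rcoeff (f : SkewPoly σ δ) (i : ℕ) : F :=
  ∑ j ∈ Finset.range (f.natDegree - i + 1), (-1) ^ j * wordT σ δ j i (f.coeff (j + i))

/-- The coefficient of `x ^ l` in `x ^ k f` (coefficients on the left),
`∑_{i = 0}^k 𝒞_{k-i,i}(a_{l-i})` with `a_j = 0` for `j < 0`. -/
def sylvEntry (f : SkewPoly σ δ) (k l : ℕ) : F :=
  ∑ i ∈ Finset.range (k + 1), if i ≤ l then wordC σ δ (k - i) i (f.coeff (l - i)) else 0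

/-- The coefficient of `x ^ l` in `f x ^ k` (coefficients on the right),
`∑_{i = 0}^k (-1) ^ (k + i) 𝒯_{k-i,i}(A_{l-i})` with `A_j = 0` for `j < 0`. -/
def sylvEntryL (f : SkewPoly σ δ) (k l : ℕ) : F :=
  ∑ i ∈ Finset.range (k + 1),
    if i ≤ l then (-1) ^ (k + i) * wordT σ δ (k - i) i (f.rcoeff (l - i)) else 0

/-- The right Sylvester matrix of `f` and `g`, of degrees `m` and `n`: the matrix `A` of the system
`(c_0, …, c_{n-1}, d_0, …, d_{m-1}) A = 0` that expresses `c f + d g = 0`, where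
`c = ∑_{i < n} c_i x ^ i` and `d = ∑_{i < m} d_i x ^ i`. The first `n` rows come from `f`, the last
`m` rows from `g`. -/
def sylvester (f g : SkewPoly σ δ) :
    Matrix (Fin (g.natDegree + f.natDegree)) (Fin (g.natDegree + f.natDegree)) F :=
  Matrix.of fun p l =>
    Fin.addCases (fun k => sylvEntry f k l) (fun k => sylvEntry g k l) p

/-- The left Sylvester matrix of `f` and `g`, of degrees `m` and `n`: the matrix `M` of the system
`M (C_0, …, C_{n-1}, D_0, …, D_{m-1})ᵀ = 0` that expresses `f c + g d = 0`, where
`c = ∑_{i < n} x ^ i C_i` and `d = ∑_{i < m} x ^ i D_i`. The unknowns multiply the entries on the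
right, so the first `n` columns come from `f` and the last `m` columns from `g`. -/
def sylvesterL (f g : SkewPoly σ δ) :
    Matrix (Fin (g.natDegree + f.natDegree)) (Fin (g.natDegree + f.natDegree)) F :=
  Matrix.of fun l p =>
    Fin.addCases (fun k => sylvEntryL f k l) (fun k => sylvEntryL g k l) p

/-- The right `(σ, δ)`-resultant. -/
def resultant (f g : SkewPoly σ δ) : WithZero (Abelianization Fˣ) := Ddet _ (sylvester f g)

/-- The left `(σ, δ)`-resultant. -/
def resultantL (f g : SkewPoly σ δ) : WithZero (Abelianization Fˣ) := Ddet _ (sylvesterL f g)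

end SkewPoly

end

/-! Everything reduces to one remainder per level. Dividing `Δ_a^j f` once more by `x - a` gives
`Δ_a^j f = Δ_a^{j+1} f * (x - a) + c_j` with the constant `c_j = (Δ_a^j f)(a)`, and in part (I) each
of the four conditions says that `c_j = 0` for all `j < r`. For multiplicity this is iterated
division together with uniqueness of quotients.

Put `g = Δ_a^{j+1} f`; it has positive degree because `r < deg f`. A common left divisor of `g * (x
- a) + c` and `g` divides `c`. So the gcld is `1` if `c ≠ 0`, while for `c = 0` the nonconstant `g`
is itself a common left divisor. This is why right division goes with left divisors and the left
resultant; part (II) is the mirror image. See `gcld_ne_one_iff` and `gcrd_ne_one_iff`.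

For the resultants, Gaussian elimination shows that the Dieudonné determinant vanishes exactly when
the matrix has a nonzero kernel vector, on either side. The Sylvester matrices encode `c f + d g`
and `f c + g d`, so a zero resultant means a nontrivial relation with bounded degrees
(`resultant_eq_zero_iff`, `resultantL_eq_zero_iff`). When `f` and `g` are consecutive derivative
polynomials, comparing degrees rules such a relation out unless the remainder is zero. -/

noncomputable section

/-! ### Vanishing of the Dieudonné determinant and kernel vectors. -/

section DieudonneDeterminant

variable {F : Type*} [DivisionRing F]

/-- Vanishing of the Dieudonné determinant passes to the Schur complement of the pivot. -/
theorem exists_Ddet_succ_eq_zero_iff {n : ℕ} (A : Matrix (Fin (n + 1)) (Fin (n + 1)) F)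
    (h : ∃ i, A i 0 ≠ 0) :
    ∃ p, A p 0 ≠ 0 ∧ (Ddet (n + 1) A = 0 ↔ Ddet n (Matrix.of fun k l =>
      A (p.succAbove k) l.succ - A (p.succAbove k) 0 * (A p 0)⁻¹ * A p l.succ) = 0) := by
  classical
  rw [Ddet, dif_pos h]
  -- The pivot factor is the class of a unit, hence nonzero in `WithZero`, so only the smaller
  -- determinant can vanish.
  exact ⟨_, @Fin.find_spec _ _ (_) h, by rw [mul_eq_zero, or_iff_right WithZero.coe_ne_zero]⟩

/-- Left row operations preserve the equations `A v = 0`. The pivot row determines `v 0` from the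
other coordinates, and substituting it leaves the system of the Schur complement. -/
theorem Ddet_eq_zero_iff_exists_mulVec {n : ℕ} (A : Matrix (Fin n) (Fin n) F) :
    Ddet n A = 0 ↔ ∃ v : Fin n → F, v ≠ 0 ∧ ∀ i, ∑ j, A i j * v j = 0 := by
  induction n with
  | zero =>
    simp only [Ddet, one_ne_zero, false_iff, not_exists, not_and]
    exact fun v hv => (hv (Subsingleton.elim _ _)).elim
  | succ n ih =>
    by_cases h : ∃ i, A i 0 ≠ 0
    · obtain ⟨p, hp, hdet⟩ := exists_Ddet_succ_eq_zero_iff A h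
      rw [hdet, ih]
      constructor
      · rintro ⟨v, hv, h0⟩
        refine ⟨Fin.cons (-((A p 0)⁻¹ * ∑ j, A p j.succ * v j)) v, fun h => hv ?_, ?_⟩
        · funext j
          exact congrFun h j.succ
        · have hrow : ∑ j, A p j * (Fin.cons (-((A p 0)⁻¹ * ∑ j, A p j.succ * v j)) v :
              Fin (n + 1) → F) j = 0 := by
            rw [Fin.sum_univ_succ]
            simp [mul_inv_cancel_left₀ hp]
          intro i
          rcases Fin.eq_self_or_eq_succAbove p i with rfl | ⟨k, rfl⟩
          · exact hrow
          · have := h0 k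
            rw [Fin.sum_univ_succ]
            simp only [Fin.cons_zero, Fin.cons_succ, Matrix.of_apply, sub_mul,
              Finset.sum_sub_distrib, mul_assoc, ← Finset.mul_sum] at this ⊢
            rw [mul_neg, neg_add_eq_sub, this]
      · rintro ⟨v, hv, h0⟩
        have hp0 := h0 p
        rw [Fin.sum_univ_succ] at hp0
        have hv0 : v 0 = -((A p 0)⁻¹ * ∑ j : Fin n, A p j.succ * v j.succ) := by
          rw [eq_neg_of_add_eq_zero_right hp0, mul_neg, inv_mul_cancel_left₀ hp, neg_neg]
        refine ⟨fun j => v j.succ, fun h => hv ?_, fun k => ?_⟩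
        · have h' : ∀ j : Fin n, v j.succ = 0 := fun j => congrFun h j
          funext j
          refine Fin.cases ?_ (fun j => ?_) j
          · simp [hv0, h']
          · exact h' j
        · have := h0 (p.succAbove k)
          rw [Fin.sum_univ_succ, hv0, mul_neg, neg_add_eq_sub] at this
          simp only [Matrix.of_apply, sub_mul, Finset.sum_sub_distrib, mul_assoc, ← Finset.mul_sum]
          exact this
    · push Not at h
      -- With a zero first column, the first basis vector is in the kernel.
      refine iff_of_true (by rw [Ddet, dif_neg (by simpa using h)]) ⟨Pi.single 0 1, by simp, fun i => ?_⟩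
      rw [Fin.sum_univ_succ]
      simp [h]

/-- Here column `0` is the equation that determines the coordinate at the pivot row `p`; the
remaining columns then give the system of the Schur complement. Over a division ring the two kernels
need separate arguments, as transposition is not available. -/
theorem Ddet_eq_zero_iff_exists_vecMul {n : ℕ} (A : Matrix (Fin n) (Fin n) F) :
    Ddet n A = 0 ↔ ∃ v : Fin n → F, v ≠ 0 ∧ ∀ j, ∑ i, v i * A i j = 0 := by
  induction n with
  | zero =>
    simp only [Ddet, one_ne_zero, false_iff, not_exists, not_and]
    exact fun v hv => (hv (Subsingleton.elim _ _)).elim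
  | succ n ih =>
    by_cases h : ∃ i, A i 0 ≠ 0
    · obtain ⟨p, hp, hdet⟩ := exists_Ddet_succ_eq_zero_iff A h
      rw [hdet, ih]
      constructor
      · rintro ⟨v, hv, h0⟩
        refine ⟨p.insertNth (-((∑ k, v k * A (p.succAbove k) 0) * (A p 0)⁻¹)) v,
          fun h => hv ?_, fun j => ?_⟩
        · funext k
          simpa using congrFun h (p.succAbove k)
        · rw [Fin.sum_univ_succAbove _ p]
          simp only [Fin.insertNth_apply_same, Fin.insertNth_apply_succAbove]
          refine Fin.cases ?_ (fun l => ?_) j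
          · rw [neg_mul, inv_mul_cancel_right₀ hp, neg_add_cancel]
          · have := h0 l
            simp only [Matrix.of_apply, mul_sub, Finset.sum_sub_distrib, ← mul_assoc,
              ← Finset.sum_mul] at this
            rw [neg_mul, neg_add_eq_sub, this]
      · rintro ⟨v, hv, h0⟩
        have hp0 := h0 0
        rw [Fin.sum_univ_succAbove _ p] at hp0
        have hv0 : v p = -((∑ k, v (p.succAbove k) * A (p.succAbove k) 0) * (A p 0)⁻¹) := by
          rw [eq_neg_of_add_eq_zero_right hp0, neg_mul, mul_inv_cancel_right₀ hp, neg_neg]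
        refine ⟨fun k => v (p.succAbove k), fun h => hv ?_, fun l => ?_⟩
        · have h' : ∀ k, v (p.succAbove k) = 0 := fun k => congrFun h k
          funext i
          rcases Fin.eq_self_or_eq_succAbove p i with rfl | ⟨k, rfl⟩
          · simp [hv0, h']
          · exact h' k
        · have := h0 l.succ
          rw [Fin.sum_univ_succAbove _ p, hv0, neg_mul, neg_add_eq_sub] at this
          simp only [Matrix.of_apply, mul_sub, Finset.sum_sub_distrib, ← mul_assoc,
            ← Finset.sum_mul]
          exact this
    · push Not at h
      refine iff_of_true (by rw [Ddet, dif_neg (by simpa using h)]) ?_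
      -- The zero column imposes no condition, which leaves `n` equations in `n + 1` unknowns.
      have hker := LinearMap.ker_ne_bot_of_finrank_lt (K := F)
        (f := Matrix.vecMulLinear (A.submatrix id (Fin.succ : Fin n → Fin (n + 1)))) (by simp)
      obtain ⟨v, hv, hv0⟩ := Submodule.exists_mem_ne_zero_of_ne_bot hker
      refine ⟨v, hv0, fun j => ?_⟩
      refine Fin.cases (by simp [h]) (fun l => ?_) j
      simpa [Matrix.vecMul, dotProduct] using congrFun (LinearMap.mem_ker.1 hv) l

end DieudonneDeterminant

namespace SkewPoly

variable {F : Type*} [DivisionRing F] {σ : F ≃+* F} {δ : SigmaDerivation σ}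

/-! ### Coefficients and degrees -/

@[ext]
theorem ext {f g : SkewPoly σ δ} (h : ∀ i, f.coeff i = g.coeff i) : f = g :=
  Finsupp.ext h

@[simp]
theorem coeff_zero (i : ℕ) : (0 : SkewPoly σ δ).coeff i = 0 := rfl

@[simp]
theorem coeff_add (f g : SkewPoly σ δ) (i : ℕ) : (f + g).coeff i = f.coeff i + g.coeff i := rfl

@[simp]
theorem coeff_neg (f : SkewPoly σ δ) (i : ℕ) : (-f).coeff i = -f.coeff i := rfl

@[simp]
theorem coeff_sub (f g : SkewPoly σ δ) (i : ℕ) : (f - g).coeff i = f.coeff i - g.coeff i := rfl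

theorem coeff_sum {ι : Type*} (s : Finset ι) (f : ι → SkewPoly σ δ) (i : ℕ) :
    (∑ k ∈ s, f k).coeff i = ∑ k ∈ s, (f k).coeff i :=
  Finsupp.finsetSum_apply s f i

theorem coeff_monomial (i j : ℕ) (a : F) :
    (monomial i a : SkewPoly σ δ).coeff j = if i = j then a else 0 :=
  Finsupp.single_apply

theorem coeff_C (a : F) (j : ℕ) : (C a : SkewPoly σ δ).coeff j = if j = 0 then a else 0 := by
  rw [C, coeff_monomial]
  simp only [eq_comm]

theorem coeff_C_zero (a : F) : (C a : SkewPoly σ δ).coeff 0 = a := by simp [coeff_C]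

theorem coeff_X (j : ℕ) : (X : SkewPoly σ δ).coeff j = if 1 = j then 1 else 0 :=
  coeff_monomial _ _ _

theorem C_add (a b : F) : (C (a + b) : SkewPoly σ δ) = C a + C b := monomial_add 0 a b

theorem C_zero : (C 0 : SkewPoly σ δ) = 0 := monomial_zero 0

theorem C_one : (C 1 : SkewPoly σ δ) = 1 := rfl

theorem C_mul (a b : F) : (C (a * b) : SkewPoly σ δ) = C a * C b := by
  simp only [C, mul_def, mulLeftHom_monomial, pow_zero, AddMonoid.End.coe_one, id, smul_monomial]

/-- Constants, as a ring homomorphism. -/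
def CHom (σ : F ≃+* F) (δ : SigmaDerivation σ) : F →+* SkewPoly σ δ where
  toFun := C
  map_zero' := C_zero
  map_one' := rfl
  map_add' := C_add
  map_mul' := C_mul

theorem C_neg (a : F) : (C (-a) : SkewPoly σ δ) = -C a := map_neg (CHom σ δ) a

theorem C_sub (a b : F) : (C (a - b) : SkewPoly σ δ) = C a - C b := map_sub (CHom σ δ) a b

theorem C_sum {ι : Type*} (s : Finset ι) (f : ι → F) :
    (C (∑ i ∈ s, f i) : SkewPoly σ δ) = ∑ i ∈ s, C (f i) := map_sum (CHom σ δ) f s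

theorem C_eq_zero {a : F} : (C a : SkewPoly σ δ) = 0 ↔ a = 0 :=
  ⟨fun h => by rw [← coeff_C_zero (σ := σ) (δ := δ) a, h, coeff_zero], fun h => h ▸ C_zero⟩

theorem coeff_C_mul (a : F) (f : SkewPoly σ δ) (i : ℕ) : (C a * f).coeff i = a * f.coeff i := by
  rw [C, mul_def, mulLeftHom_monomial, pow_zero, AddMonoid.End.coe_one, id]
  rfl

theorem coeff_eq_zero_of_natDegree_lt {f : SkewPoly σ δ} {i : ℕ} (h : f.natDegree < i) :
    f.coeff i = 0 := by
  by_contra hi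
  have hmem : i ∈ (show ℕ →₀ F from f).support := Finsupp.mem_support_iff.2 hi
  obtain ⟨m, hm⟩ := Finset.max_of_mem hmem
  have := Finset.le_max_of_eq hmem hm
  rw [natDegree, degree, hm] at h
  exact absurd h (not_lt.2 this)

theorem coeff_natDegree_ne_zero {f : SkewPoly σ δ} (hf : f ≠ 0) : f.coeff f.natDegree ≠ 0 := by
  obtain ⟨m, hm⟩ := Finset.max_of_nonempty (Finsupp.support_nonempty_iff.2 hf)
  rw [natDegree, degree, hm]
  exact Finsupp.mem_support_iff.1 (Finset.mem_of_max hm)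

theorem natDegree_le {f : SkewPoly σ δ} {n : ℕ} (h : ∀ i, n < i → f.coeff i = 0) :
    f.natDegree ≤ n := by
  by_contra hn
  by_cases hf : f = 0
  · subst hf
    exact hn (Nat.zero_le n)
  · exact coeff_natDegree_ne_zero hf (h _ (not_le.1 hn))

theorem le_natDegree {f : SkewPoly σ δ} {n : ℕ} (h : f.coeff n ≠ 0) : n ≤ f.natDegree :=
  not_lt.1 fun hn => h (coeff_eq_zero_of_natDegree_lt hn)

theorem natDegree_eq {f : SkewPoly σ δ} {n : ℕ} (h : ∀ i, n < i → f.coeff i = 0)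
    (hn : f.coeff n ≠ 0) : f.natDegree = n :=
  le_antisymm (natDegree_le h) (le_natDegree hn)

theorem degree_eq_natDegree {f : SkewPoly σ δ} (hf : f ≠ 0) : f.degree = f.natDegree := by
  obtain ⟨m, hm⟩ := Finset.max_of_nonempty (Finsupp.support_nonempty_iff.2 hf)
  rw [natDegree, degree, hm]
  rfl

theorem degree_lt_iff {f : SkewPoly σ δ} {n : ℕ} :
    f.degree < n ↔ ∀ i, n ≤ i → f.coeff i = 0 := by
  by_cases hf : f = 0
  · subst hf
    exact iff_of_true (WithBot.bot_lt_coe n) (by simp)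
  · rw [degree_eq_natDegree hf, Nat.cast_lt]
    exact ⟨fun h i hi => coeff_eq_zero_of_natDegree_lt (h.trans_le hi),
      fun h => not_le.1 fun hn => coeff_natDegree_ne_zero hf (h _ hn)⟩

theorem eq_C_of_natDegree_eq_zero {f : SkewPoly σ δ} (h : f.natDegree = 0) :
    f = C (f.coeff 0) := by
  ext i
  rw [coeff_C]
  split_ifs with hi
  · rw [hi]
  · exact coeff_eq_zero_of_natDegree_lt (h ▸ Nat.pos_of_ne_zero hi)

theorem natDegree_C (a : F) : (C a : SkewPoly σ δ).natDegree = 0 :=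
  Nat.le_zero.1 (natDegree_le fun i hi => by rw [coeff_C, if_neg hi.ne'])

theorem C_mul_X_pow_coeff (a : F) (i j : ℕ) :
    (C a * X ^ i : SkewPoly σ δ).coeff j = if i = j then a else 0 := by
  rw [C_mul_X_pow, coeff_monomial]

theorem coeff_sum_C_mul_X_pow (n : ℕ) (b : ℕ → F) (j : ℕ) :
    (∑ i ∈ Finset.range n, C (b i) * (X : SkewPoly σ δ) ^ i).coeff j =
      if j < n then b j else 0 := by
  simp [coeff_sum, C_mul_X_pow_coeff]

/-- A polynomial is the sum of its terms. -/
theorem sum_C_mul_X_pow {f : SkewPoly σ δ} {n : ℕ} (h : ∀ i, n ≤ i → f.coeff i = 0) :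
    ∑ i ∈ Finset.range n, C (f.coeff i) * X ^ i = f := by
  ext j
  rw [coeff_sum_C_mul_X_pow]
  split_ifs with hj
  · rfl
  · exact (h j (not_lt.1 hj)).symm

theorem sum_range_natDegree (f : SkewPoly σ δ) :
    ∑ i ∈ Finset.range (f.natDegree + 1), C (f.coeff i) * X ^ i = f :=
  sum_C_mul_X_pow fun _ hi => coeff_eq_zero_of_natDegree_lt hi

/-! ### Degrees of products -/

theorem X_mul_coeff_succ (f : SkewPoly σ δ) (j : ℕ) :
    (X * f).coeff (j + 1) = σ (f.coeff j) + δ (f.coeff (j + 1)) := by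
  -- The range is long enough to contain both `j` and `j + 1`, whatever the degree of `f`.
  have hf : ∑ i ∈ Finset.range (f.natDegree + j + 2), C (f.coeff i) * X ^ i = f :=
    sum_C_mul_X_pow fun i hi => coeff_eq_zero_of_natDegree_lt (by omega)
  conv_lhs => rw [← hf, Finset.mul_sum]
  simp only [← mul_assoc, X_mul_C, add_mul, coeff_sum, coeff_add]
  simp only [mul_assoc, ← pow_succ', C_mul_X_pow_coeff, Finset.sum_add_distrib]
  simp [Finset.mem_range, show j < f.natDegree + j + 2 by omega]

theorem coeff_X_pow_mul_of_lt {g : SkewPoly σ δ} {n : ℕ} (h : ∀ i, n < i → g.coeff i = 0)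
    (k i : ℕ) (hi : k + n < i) : (X ^ k * g).coeff i = 0 := by
  induction k generalizing i with
  | zero => simpa using h i (by omega)
  | succ k ih =>
    obtain ⟨i, rfl⟩ : ∃ i', i = i' + 1 := ⟨i - 1, by omega⟩
    rw [pow_succ', mul_assoc, X_mul_coeff_succ, ih i (by omega), ih (i + 1) (by omega), map_zero,
      map_zero, add_zero]

/-- The `δ`-terms do not raise the degree, so the top coefficient is only twisted by `σ`. -/
theorem coeff_X_pow_mul_add {g : SkewPoly σ δ} {n : ℕ} (h : ∀ i, n < i → g.coeff i = 0) (k : ℕ) :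
    (X ^ k * g).coeff (k + n) = (σ ^ k : F ≃+* F) (g.coeff n) := by
  induction k with
  | zero => simp
  | succ k ih =>
    rw [pow_succ', mul_assoc, show k + 1 + n = k + n + 1 by omega, X_mul_coeff_succ, ih,
      coeff_X_pow_mul_of_lt h k _ (by omega), map_zero, add_zero, pow_succ']
    rfl

theorem coeff_mul_of_lt {f g : SkewPoly σ δ} {m n : ℕ} (hf : ∀ i, m < i → f.coeff i = 0)
    (hg : ∀ i, n < i → g.coeff i = 0) (i : ℕ) (hi : m + n < i) : (f * g).coeff i = 0 := by
  rw [← sum_C_mul_X_pow (n := m + 1) fun i hi => hf i hi, Finset.sum_mul, coeff_sum]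
  refine Finset.sum_eq_zero fun k hk => ?_
  rw [Finset.mem_range] at hk
  rw [mul_assoc, coeff_C_mul, coeff_X_pow_mul_of_lt hg k i (by omega), mul_zero]

theorem coeff_mul_add {f g : SkewPoly σ δ} {m n : ℕ} (hf : ∀ i, m < i → f.coeff i = 0)
    (hg : ∀ i, n < i → g.coeff i = 0) :
    (f * g).coeff (m + n) = f.coeff m * (σ ^ m : F ≃+* F) (g.coeff n) := by
  conv_lhs => rw [← sum_C_mul_X_pow (n := m + 1) fun i hi => hf i hi, Finset.sum_mul, coeff_sum]
  rw [Finset.sum_range_succ, mul_assoc, coeff_C_mul, coeff_X_pow_mul_add hg,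
    Finset.sum_eq_zero, zero_add]
  intro k hk
  rw [Finset.mem_range] at hk
  rw [mul_assoc, coeff_C_mul, coeff_X_pow_mul_of_lt hg k _ (by omega), mul_zero]

/-- The top coefficient is a product of two nonzero elements of `F`, as `σ` is injective. Additivity
of degrees and the absence of zero divisors follow. -/
theorem coeff_mul_natDegree_add_ne_zero {f g : SkewPoly σ δ} (hf : f ≠ 0) (hg : g ≠ 0) :
    (f * g).coeff (f.natDegree + g.natDegree) ≠ 0 := by
  rw [coeff_mul_add (fun _ => coeff_eq_zero_of_natDegree_lt)
    (fun _ => coeff_eq_zero_of_natDegree_lt)]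
  exact mul_ne_zero (coeff_natDegree_ne_zero hf)
    ((map_ne_zero_iff _ (RingEquiv.injective _)).2 (coeff_natDegree_ne_zero hg))

theorem natDegree_mul {f g : SkewPoly σ δ} (hf : f ≠ 0) (hg : g ≠ 0) :
    (f * g).natDegree = f.natDegree + g.natDegree :=
  natDegree_eq (coeff_mul_of_lt (fun _ => coeff_eq_zero_of_natDegree_lt)
    (fun _ => coeff_eq_zero_of_natDegree_lt)) (coeff_mul_natDegree_add_ne_zero hf hg)

instance : Nontrivial (SkewPoly σ δ) :=
  ⟨1, 0, fun h => one_ne_zero (C_eq_zero.1 ((C_one (σ := σ) (δ := δ)).trans h))⟩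

instance : NoZeroDivisors (SkewPoly σ δ) where
  eq_zero_or_eq_zero_of_mul_eq_zero {f g} h := by
    by_contra! hfg
    exact coeff_mul_natDegree_add_ne_zero hfg.1 hfg.2 (by rw [h, coeff_zero])

instance : IsDomain (SkewPoly σ δ) := NoZeroDivisors.to_isDomain _

theorem natDegree_X_sub_C (a : F) : (X - C a : SkewPoly σ δ).natDegree = 1 :=
  natDegree_eq (fun i hi => by
    rw [coeff_sub, coeff_X, coeff_C, if_neg (by omega), if_neg (by omega), sub_zero])
    (by simp [coeff_X, coeff_C])

theorem X_sub_C_ne_zero (a : F) : (X - C a : SkewPoly σ δ) ≠ 0 := fun h => by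
  have := natDegree_X_sub_C (σ := σ) (δ := δ) a
  rw [h, ← C_zero, natDegree_C] at this
  exact zero_ne_one this

theorem natDegree_X_sub_C_pow (a : F) (j : ℕ) : ((X - C a : SkewPoly σ δ) ^ j).natDegree = j := by
  induction j with
  | zero => exact natDegree_C 1
  | succ j ih =>
    rw [pow_succ, natDegree_mul (pow_ne_zero j (X_sub_C_ne_zero a)) (X_sub_C_ne_zero a), ih,
      natDegree_X_sub_C]

theorem degree_X_sub_C_pow (a : F) (j : ℕ) : ((X - C a : SkewPoly σ δ) ^ j).degree = j := by
  rw [degree_eq_natDegree (pow_ne_zero j (X_sub_C_ne_zero a)), natDegree_X_sub_C_pow]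

/-! ### Division by `x - a` -/

/-- The commutation rule read backwards. It needs `σ` to be surjective, and left division and
right-hand coefficients depend on it. -/
theorem C_mul_X (a : F) :
    (C a * X : SkewPoly σ δ) = X * C (σ.symm a) - C (δ (σ.symm a)) := by
  rw [X_mul_C, σ.apply_symm_apply, add_sub_cancel_right]

theorem exists_eq_mul_X_sub_C_add (a : F) (f : SkewPoly σ δ) :
    ∃ (q : SkewPoly σ δ) (c : F), f = q * (X - C a) + C c := by
  have hX : ∀ (g : SkewPoly σ δ), (∃ (q : SkewPoly σ δ) (c : F), g = q * (X - C a) + C c) →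
      ∃ (q : SkewPoly σ δ) (c : F), X * g = q * (X - C a) + C c := by
    rintro _ ⟨q, c, rfl⟩
    -- The remainder is updated by `x c = σ(c) x + δ(c) = σ(c) (x - a) + (σ(c) a + δ(c))`.
    refine ⟨X * q + C (σ c), σ c * a + δ c, ?_⟩
    rw [mul_add, X_mul_C, C_add, C_mul]
    simp only [add_mul, mul_sub, mul_assoc]
    abel
  induction f using induction_on with
  | h0 => exact ⟨0, 0, by rw [C_zero, zero_mul, add_zero]⟩
  | hadd f g hf hg =>
    obtain ⟨q, c, rfl⟩ := hf
    obtain ⟨q', c', rfl⟩ := hg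
    exact ⟨q + q', c + c', by rw [C_add, add_mul]; abel⟩
  | hm i b =>
    have hpow : ∃ (q : SkewPoly σ δ) (c : F), (X : SkewPoly σ δ) ^ i = q * (X - C a) + C c := by
      induction i with
      | zero => exact ⟨0, 1, by rw [pow_zero, zero_mul, zero_add, C_one]⟩
      | succ i ih => exact pow_succ' (X : SkewPoly σ δ) i ▸ hX _ ih
    obtain ⟨q, c, hq⟩ := hpow
    exact ⟨C b * q, b * c, by rw [← C_mul_X_pow, hq, mul_add, mul_assoc, C_mul]⟩

theorem exists_eq_X_sub_C_mul_add (a : F) (f : SkewPoly σ δ) :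
    ∃ (q : SkewPoly σ δ) (c : F), f = (X - C a) * q + C c := by
  induction f using induction_on with
  | h0 => exact ⟨0, 0, by rw [C_zero, mul_zero, add_zero]⟩
  | hadd f g hf hg =>
    obtain ⟨q, c, rfl⟩ := hf
    obtain ⟨q', c', rfl⟩ := hg
    exact ⟨q + q', c + c', by rw [C_add, mul_add]; abel⟩
  | hm i b =>
    rw [← C_mul_X_pow]
    induction i with
    | zero => exact ⟨0, b, by rw [pow_zero, mul_zero, zero_add, mul_one]⟩
    | succ i ih =>
      obtain ⟨q, c, hq⟩ := ih
      -- Multiplication by `x` on the right respects left multiples of `x - a`, and `c x = x σ⁻¹(c)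
      -- - δ(σ⁻¹(c))` gives the new constant.
      refine ⟨q * X + C (σ.symm c), a * σ.symm c - δ (σ.symm c), ?_⟩
      rw [pow_succ, ← mul_assoc, hq, add_mul, C_mul_X, C_sub, C_mul]
      simp only [mul_add, sub_mul, mul_assoc]
      abel

theorem eq_zero_of_degree_mul_lt {g p : SkewPoly σ δ} (h : (p * g).degree < g.degree) :
    p = 0 := by
  by_contra hp
  by_cases hg : g = 0
  · subst hg
    simp at h
  · rw [degree_eq_natDegree hg, degree_lt_iff] at h
    exact coeff_mul_natDegree_add_ne_zero hp hg (h _ (by omega))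

theorem eq_zero_of_degree_mul_lt' {g p : SkewPoly σ δ} (h : (g * p).degree < g.degree) :
    p = 0 := by
  by_contra hp
  by_cases hg : g = 0
  · subst hg
    simp at h
  · rw [degree_eq_natDegree hg, degree_lt_iff] at h
    exact coeff_mul_natDegree_add_ne_zero hg hp (h _ (by omega))

theorem degree_sub_lt {s t g : SkewPoly σ δ} (hs : s.degree < g.degree) (ht : t.degree < g.degree) :
    (s - t).degree < g.degree := by
  by_cases hg : g = 0
  · subst hg
    exact absurd hs not_lt_bot
  · rw [degree_eq_natDegree hg, degree_lt_iff] at *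
    exact fun i hi => by rw [coeff_sub, hs i hi, ht i hi, sub_zero]

theorem right_division_unique {g q q' s s' : SkewPoly σ δ} (h : q * g + s = q' * g + s')
    (hs : s.degree < g.degree) (hs' : s'.degree < g.degree) : q = q' ∧ s = s' := by
  have h1 : (q - q') * g = s' - s := by
    rw [sub_mul, sub_eq_sub_iff_add_eq_add, h, add_comm]
  have hq : q = q' := sub_eq_zero.1 (eq_zero_of_degree_mul_lt (h1 ▸ degree_sub_lt hs' hs))
  exact ⟨hq, by subst hq; exact add_left_cancel h⟩

theorem left_division_unique {g q q' s s' : SkewPoly σ δ} (h : g * q + s = g * q' + s')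
    (hs : s.degree < g.degree) (hs' : s'.degree < g.degree) : q = q' ∧ s = s' := by
  have h1 : g * (q - q') = s' - s := by
    rw [mul_sub, sub_eq_sub_iff_add_eq_add, h, add_comm]
  have hq : q = q' := sub_eq_zero.1 (eq_zero_of_degree_mul_lt' (h1 ▸ degree_sub_lt hs' hs))
  exact ⟨hq, by subst hq; exact add_left_cancel h⟩

/-- The quotient is defined by choice; uniqueness of division lets any explicit division compute it.
-/
theorem rightQuot_eq {f g q s : SkewPoly σ δ} (h : f = q * g + s) (hs : s.degree < g.degree) :
    rightQuot f g = q := by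
  have hex : ∃ q s : SkewPoly σ δ, f = q * g + s ∧ s.degree < g.degree := ⟨q, s, h, hs⟩
  rw [rightQuot, dif_pos hex]
  obtain ⟨s', h', hs'⟩ := hex.choose_spec
  exact (right_division_unique (h'.symm.trans h) hs' hs).1

theorem leftQuot_eq {f g q s : SkewPoly σ δ} (h : f = g * q + s) (hs : s.degree < g.degree) :
    leftQuot f g = q := by
  have hex : ∃ q s : SkewPoly σ δ, f = g * q + s ∧ s.degree < g.degree := ⟨q, s, h, hs⟩
  rw [leftQuot, dif_pos hex]
  obtain ⟨s', h', hs'⟩ := hex.choose_spec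
  exact (left_division_unique (h'.symm.trans h) hs' hs).1

theorem degree_C_lt (c a : F) : (C c : SkewPoly σ δ).degree < (X - C a : SkewPoly σ δ).degree := by
  rw [← pow_one (X - C a), degree_X_sub_C_pow, degree_lt_iff]
  exact fun i hi => by rw [coeff_C, if_neg (by omega)]

theorem rightEval_eq {f q : SkewPoly σ δ} {a c : F} (h : f = q * (X - C a) + C c) :
    f.rightEval a = c := by
  rw [rightEval, rightRem, rightQuot_eq h (degree_C_lt c a), h, add_sub_cancel_left, coeff_C_zero]

theorem leftEval_eq {f q : SkewPoly σ δ} {a c : F} (h : f = (X - C a) * q + C c) :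
    f.leftEval a = c := by
  rw [leftEval, leftRem, leftQuot_eq h (degree_C_lt c a), h, add_sub_cancel_left, coeff_C_zero]

/-! ### Derivative polynomials -/

theorem rightDer_eq {f q s : SkewPoly σ δ} {a : F} {j : ℕ} (h : f = q * (X - C a) ^ j + s)
    (hs : s.degree < j) : rightDer a j f = q := by
  cases j with
  | zero =>
    have : s = 0 := ext fun i => degree_lt_iff.1 hs i (Nat.zero_le i)
    rw [rightDer, h, this, pow_zero, mul_one, add_zero]
  | succ j => exact rightQuot_eq h (by rwa [degree_X_sub_C_pow])

theorem leftDer_eq {f q s : SkewPoly σ δ} {a : F} {j : ℕ} (h : f = (X - C a) ^ j * q + s)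
    (hs : s.degree < j) : leftDer a j f = q := by
  cases j with
  | zero =>
    have : s = 0 := ext fun i => degree_lt_iff.1 hs i (Nat.zero_le i)
    rw [leftDer, h, this, pow_zero, one_mul, add_zero]
  | succ j => exact leftQuot_eq h (by rwa [degree_X_sub_C_pow])

theorem coeff_X_sub_C_pow_of_lt (a : F) {i j : ℕ} (h : j < i) :
    ((X - C a : SkewPoly σ δ) ^ j).coeff i = 0 :=
  coeff_eq_zero_of_natDegree_lt (by rwa [natDegree_X_sub_C_pow])

/-- Dividing the quotient by `x - a` turns a division of `f` by `(x - a) ^ j` into one by `(x - a) ^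
(j + 1)`, with remainder `c (x - a) ^ j + s`. Existence at the next level comes with it, so
induction covers all powers without a general division algorithm. -/
theorem rightDer_eq_rightDer_succ_mul_add_of_eq {f s : SkewPoly σ δ} {a : F} {j : ℕ}
    (hs : f = rightDer a j f * (X - C a) ^ j + s) (hd : s.degree < j) :
    rightDer a j f = rightDer a (j + 1) f * (X - C a) + C ((rightDer a j f).rightEval a) ∧
      ∃ t : SkewPoly σ δ, f = rightDer a (j + 1) f * (X - C a) ^ (j + 1) + t ∧
        t.degree < ((j + 1 : ℕ) : WithBot ℕ) := by
  obtain ⟨q, c, hq⟩ := exists_eq_mul_X_sub_C_add a (rightDer a j f)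
  have h : f = q * (X - C a) ^ (j + 1) + (C c * (X - C a) ^ j + s) := by
    conv_lhs => rw [hs, hq, add_mul, mul_assoc, ← pow_succ', add_assoc]
  have hd' : (C c * (X - C a) ^ j + s).degree < ((j + 1 : ℕ) : WithBot ℕ) := by
    rw [degree_lt_iff] at hd ⊢
    exact fun i hi => by rw [coeff_add, coeff_C_mul, coeff_X_sub_C_pow_of_lt a hi, mul_zero,
      hd i (by omega), add_zero]
  rw [rightEval_eq hq, rightDer_eq h hd']
  exact ⟨hq, _, h, hd'⟩

theorem leftDer_eq_mul_leftDer_succ_add_of_eq {f s : SkewPoly σ δ} {a : F} {j : ℕ}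
    (hs : f = (X - C a) ^ j * leftDer a j f + s) (hd : s.degree < j) :
    leftDer a j f = (X - C a) * leftDer a (j + 1) f + C ((leftDer a j f).leftEval a) ∧
      ∃ t : SkewPoly σ δ, f = (X - C a) ^ (j + 1) * leftDer a (j + 1) f + t ∧
        t.degree < ((j + 1 : ℕ) : WithBot ℕ) := by
  obtain ⟨q, c, hq⟩ := exists_eq_X_sub_C_mul_add a (leftDer a j f)
  have h : f = (X - C a) ^ (j + 1) * q + ((X - C a) ^ j * C c + s) := by
    conv_lhs => rw [hs, hq, mul_add, ← mul_assoc, ← pow_succ, add_assoc]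
  have hd' : ((X - C a) ^ j * C c + s).degree < ((j + 1 : ℕ) : WithBot ℕ) := by
    rw [degree_lt_iff] at hd ⊢
    intro i hi
    rw [coeff_add, coeff_mul_of_lt (m := j) (n := 0) (fun k hk => coeff_X_sub_C_pow_of_lt a hk)
      (fun k hk => by rw [coeff_C, if_neg hk.ne']) i (by omega), hd i (by omega), add_zero]
  rw [leftEval_eq hq, leftDer_eq h hd']
  exact ⟨hq, _, h, hd'⟩

theorem exists_eq_rightDer_mul_add (f : SkewPoly σ δ) (a : F) (j : ℕ) :
    ∃ s : SkewPoly σ δ, f = rightDer a j f * (X - C a) ^ j + s ∧ s.degree < j := by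
  induction j with
  | zero => exact ⟨0, by rw [pow_zero, mul_one, add_zero]; rfl, degree_lt_iff.2 fun _ _ => rfl⟩
  | succ j ih =>
    obtain ⟨s, hs, hd⟩ := ih
    exact (rightDer_eq_rightDer_succ_mul_add_of_eq hs hd).2

theorem exists_eq_mul_leftDer_add (f : SkewPoly σ δ) (a : F) (j : ℕ) :
    ∃ s : SkewPoly σ δ, f = (X - C a) ^ j * leftDer a j f + s ∧ s.degree < j := by
  induction j with
  | zero => exact ⟨0, by rw [pow_zero, one_mul, add_zero]; rfl, degree_lt_iff.2 fun _ _ => rfl⟩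
  | succ j ih =>
    obtain ⟨s, hs, hd⟩ := ih
    exact (leftDer_eq_mul_leftDer_succ_add_of_eq hs hd).2

/-- Consecutive right derivative polynomials differ by a right division by `x - a`. -/
theorem rightDer_eq_rightDer_succ_mul_add (f : SkewPoly σ δ) (a : F) (j : ℕ) :
    rightDer a j f =
      rightDer a (j + 1) f * (X - C a) + C ((rightDer a j f).rightEval a) := by
  obtain ⟨s, hs, hd⟩ := exists_eq_rightDer_mul_add f a j
  exact (rightDer_eq_rightDer_succ_mul_add_of_eq hs hd).1

/-- Consecutive left derivative polynomials differ by a left division by `x - a`. -/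
theorem leftDer_eq_mul_leftDer_succ_add (f : SkewPoly σ δ) (a : F) (j : ℕ) :
    leftDer a j f =
      (X - C a) * leftDer a (j + 1) f + C ((leftDer a j f).leftEval a) := by
  obtain ⟨s, hs, hd⟩ := exists_eq_mul_leftDer_add f a j
  exact (leftDer_eq_mul_leftDer_succ_add_of_eq hs hd).1

/-- If `f = q (x - a) ^ r`, uniqueness gives `Δ_a^j f = q (x - a) ^ (r - j)`, which still has a
factor `x - a`. Conversely, vanishing remainders let the successive divisions telescope. -/
theorem isRightRootOfMultGE_iff (f : SkewPoly σ δ) (a : F) (r : ℕ) :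
    f.IsRightRootOfMultGE a r ↔ ∀ j < r, (rightDer a j f).IsRightRoot a := by
  constructor
  · rintro ⟨q, hq⟩ j hj
    have h : f = q * (X - C a) ^ (r - j) * (X - C a) ^ j + 0 := by
      rw [mul_assoc, ← pow_add, Nat.sub_add_cancel hj.le, add_zero, hq]
    rw [IsRightRoot, rightDer_eq h (degree_lt_iff.2 fun _ _ => rfl)]
    refine rightEval_eq (q := q * (X - C a) ^ (r - j - 1)) ?_
    rw [C_zero, add_zero, mul_assoc, ← pow_succ, show r - j - 1 + 1 = r - j by omega]
  · intro h
    have key : ∀ j ≤ r, f = rightDer a j f * (X - C a) ^ j := by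
      intro j
      induction j with
      | zero => exact fun _ => by rw [pow_zero, mul_one]; rfl
      | succ j ih =>
        intro hj
        have h1 := rightDer_eq_rightDer_succ_mul_add f a j
        rw [h j hj, C_zero, add_zero] at h1
        rw [pow_succ', ← mul_assoc, ← h1]
        exact ih (by omega)
    exact ⟨_, key r le_rfl⟩

theorem isLeftRootOfMultGE_iff (f : SkewPoly σ δ) (a : F) (r : ℕ) :
    f.IsLeftRootOfMultGE a r ↔ ∀ j < r, (leftDer a j f).IsLeftRoot a := by
  constructor
  · rintro ⟨q, hq⟩ j hj
    have h : f = (X - C a) ^ j * ((X - C a) ^ (r - j) * q) + 0 := by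
      rw [← mul_assoc, ← pow_add, Nat.add_sub_cancel' hj.le, add_zero, hq]
    rw [IsLeftRoot, leftDer_eq h (degree_lt_iff.2 fun _ _ => rfl)]
    refine leftEval_eq (q := (X - C a) ^ (r - j - 1) * q) ?_
    rw [C_zero, add_zero, ← mul_assoc, ← pow_succ', show r - j - 1 + 1 = r - j by omega]
  · intro h
    have key : ∀ j ≤ r, f = (X - C a) ^ j * leftDer a j f := by
      intro j
      induction j with
      | zero => exact fun _ => by rw [pow_zero, one_mul]; rfl
      | succ j ih =>
        intro hj
        have h1 := leftDer_eq_mul_leftDer_succ_add f a j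
        rw [h j hj, C_zero, add_zero] at h1
        rw [pow_succ, mul_assoc, ← h1]
        exact ih (by omega)
    exact ⟨_, key r le_rfl⟩

theorem natDegree_add_C {f : SkewPoly σ δ} (hf : 0 < f.natDegree) (c : F) :
    (f + C c).natDegree = f.natDegree := by
  have hf0 : f ≠ 0 := fun h => by rw [h, ← C_zero, natDegree_C] at hf; exact hf.false
  refine natDegree_eq (fun i hi => ?_) ?_
  · rw [coeff_add, coeff_eq_zero_of_natDegree_lt hi, coeff_C, if_neg (by omega), add_zero]
  · rw [coeff_add, coeff_C, if_neg hf.ne', add_zero]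
    exact coeff_natDegree_ne_zero hf0

theorem natDegree_of_eq_mul_X_sub_C_add {f q : SkewPoly σ δ} {a c : F}
    (h : f = q * (X - C a) + C c) (hf : 0 < f.natDegree) : f.natDegree = q.natDegree + 1 := by
  by_cases hq : q = 0
  -- A zero quotient would make `f` constant.
  · rw [h, hq, zero_mul, zero_add, natDegree_C] at hf
    exact absurd hf (lt_irrefl 0)
  · have h1 : (q * (X - C a)).natDegree = q.natDegree + 1 := by
      rw [natDegree_mul hq (X_sub_C_ne_zero a), natDegree_X_sub_C]
    rw [h, natDegree_add_C (by omega), h1]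

theorem natDegree_of_eq_X_sub_C_mul_add {f q : SkewPoly σ δ} {a c : F}
    (h : f = (X - C a) * q + C c) (hf : 0 < f.natDegree) : f.natDegree = q.natDegree + 1 := by
  by_cases hq : q = 0
  · rw [h, hq, mul_zero, zero_add, natDegree_C] at hf
    exact absurd hf (lt_irrefl 0)
  · have h1 : ((X - C a) * q).natDegree = q.natDegree + 1 := by
      rw [natDegree_mul (X_sub_C_ne_zero a) hq, natDegree_X_sub_C, add_comm]
    rw [h, natDegree_add_C (by omega), h1]

theorem natDegree_rightDer (f : SkewPoly σ δ) (a : F) {j : ℕ} (hj : j ≤ f.natDegree) :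
    (rightDer a j f).natDegree = f.natDegree - j := by
  induction j with
  | zero => rfl
  | succ j ih =>
    have := natDegree_of_eq_mul_X_sub_C_add (rightDer_eq_rightDer_succ_mul_add f a j)
      (by rw [ih (by omega)]; omega)
    rw [ih (by omega)] at this
    omega

theorem natDegree_leftDer (f : SkewPoly σ δ) (a : F) {j : ℕ} (hj : j ≤ f.natDegree) :
    (leftDer a j f).natDegree = f.natDegree - j := by
  induction j with
  | zero => rfl
  | succ j ih =>
    have := natDegree_of_eq_X_sub_C_mul_add (leftDer_eq_mul_leftDer_succ_add f a j)
      (by rw [ih (by omega)]; omega)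
    rw [ih (by omega)] at this
    omega

/-! ### Greatest common divisors of consecutive derivative polynomials -/

theorem eq_one_of_monic_of_mul_eq_C {d e : SkewPoly σ δ} {c : F} (hd : d.Monic) (hc : c ≠ 0)
    (h : d * e = C c ∨ e * d = C c) : d = 1 := by
  have hC : (C c : SkewPoly σ δ) ≠ 0 := mt C_eq_zero.1 hc
  have hd0 : d ≠ 0 := by rintro rfl; simp [hC.symm] at h
  have he0 : e ≠ 0 := by rintro rfl; simp [hC.symm] at h
  have hdeg : d.natDegree = 0 := by
    rcases h with h | h
    · have := natDegree_mul hd0 he0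
      rw [h, natDegree_C] at this
      omega
    · have := natDegree_mul he0 hd0
      rw [h, natDegree_C] at this
      omega
  have h1 : d.coeff 0 = 1 := hdeg ▸ hd
  rw [eq_C_of_natDegree_eq_zero hdeg, h1, C_one]

theorem monic_one : (1 : SkewPoly σ δ).Monic := by
  rw [Monic, ← C_one, natDegree_C, coeff_C_zero]

theorem not_mul_eq_one_of_natDegree_pos {g q : SkewPoly σ δ} (hg : 0 < g.natDegree) :
    g * q ≠ 1 ∧ q * g ≠ 1 := by
  have hg0 : g ≠ 0 := fun h => by rw [h, ← C_zero, natDegree_C] at hg; exact hg.false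
  refine ⟨fun h => ?_, fun h => ?_⟩
  · have hq : q ≠ 0 := by rintro rfl; simp at h
    have := natDegree_mul hg0 hq
    rw [h, ← C_one, natDegree_C] at this
    omega
  · have hq : q ≠ 0 := by rintro rfl; simp at h
    have := natDegree_mul hq hg0
    rw [h, ← C_one, natDegree_C] at this
    omega

/-- Since `c = f - g (x - a)`, common left divisors of `f` and `g` divide the constant `c`. It is a
unit if nonzero; if it is zero, `g` itself is a common left divisor of positive degree. -/
theorem gcld_ne_one_iff {f g : SkewPoly σ δ} {a c : F} (h : f = g * (X - C a) + C c)
    (hg : 0 < g.natDegree) : gcld f g ≠ 1 ↔ c = 0 := by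
  have hdvd : ∀ e : SkewPoly σ δ, LeftDvd e f → LeftDvd e g → LeftDvd e (C c) := by
    rintro e ⟨u, hu⟩ ⟨v, hv⟩
    exact ⟨u - v * (X - C a), by
      rw [mul_sub, ← mul_assoc, ← hu, ← hv, eq_sub_iff_add_eq, add_comm, h]⟩
  constructor
  · contrapose!
    intro hc
    have h1 : IsGCLD 1 f g := by
      refine ⟨⟨f, (one_mul f).symm⟩, ⟨g, (one_mul g).symm⟩, fun e he he' => ?_⟩
      obtain ⟨u, hu⟩ := hdvd e he he'
      exact ⟨u * C c⁻¹, by rw [← mul_assoc, ← hu, ← C_mul, mul_inv_cancel₀ hc, C_one]⟩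
    have hex : ∃ d : SkewPoly σ δ, d.Monic ∧ IsGCLD d f g := ⟨1, monic_one, h1⟩
    rw [gcld, dif_pos hex]
    obtain ⟨hm, hd⟩ := hex.choose_spec
    obtain ⟨u, hu⟩ := hdvd _ hd.1 hd.2.1
    exact eq_one_of_monic_of_mul_eq_C hm hc (.inl hu.symm)
  · rintro rfl
    rw [C_zero, add_zero] at h
    rw [gcld]
    -- A gcld is left-divisible by `g`, hence not `1`. The default value `0` is not `1` either, so
    -- existence of a gcld need not be proved.
    split_ifs with hex
    · obtain ⟨u, hu⟩ := hex.choose_spec.2.2.2 g ⟨_, h⟩ ⟨1, (mul_one g).symm⟩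
      rw [hu]
      exact (not_mul_eq_one_of_natDegree_pos hg).1
    · exact zero_ne_one

theorem gcrd_ne_one_iff {f g : SkewPoly σ δ} {a c : F} (h : f = (X - C a) * g + C c)
    (hg : 0 < g.natDegree) : gcrd f g ≠ 1 ↔ c = 0 := by
  have hdvd : ∀ e : SkewPoly σ δ, RightDvd e f → RightDvd e g → RightDvd e (C c) := by
    rintro e ⟨u, hu⟩ ⟨v, hv⟩
    exact ⟨u - (X - C a) * v, by
      rw [sub_mul, mul_assoc, ← hu, ← hv, eq_sub_iff_add_eq, add_comm, h]⟩
  constructor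
  · contrapose!
    intro hc
    have h1 : IsGCRD 1 f g := by
      refine ⟨⟨f, (mul_one f).symm⟩, ⟨g, (mul_one g).symm⟩, fun e he he' => ?_⟩
      obtain ⟨u, hu⟩ := hdvd e he he'
      exact ⟨C c⁻¹ * u, by rw [mul_assoc, ← hu, ← C_mul, inv_mul_cancel₀ hc, C_one]⟩
    have hex : ∃ d : SkewPoly σ δ, d.Monic ∧ IsGCRD d f g := ⟨1, monic_one, h1⟩
    rw [gcrd, dif_pos hex]
    obtain ⟨hm, hd⟩ := hex.choose_spec
    obtain ⟨u, hu⟩ := hdvd _ hd.1 hd.2.1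
    exact eq_one_of_monic_of_mul_eq_C hm hc (.inr hu.symm)
  · rintro rfl
    rw [C_zero, add_zero] at h
    rw [gcrd]
    split_ifs with hex
    · obtain ⟨u, hu⟩ := hex.choose_spec.2.2.2 g ⟨_, h⟩ ⟨1, (one_mul g).symm⟩
      rw [hu]
      exact (not_mul_eq_one_of_natDegree_pos hg).2
    · exact zero_ne_one

end SkewPoly

/-! ### Sums over words in two maps. -/

section WordSum

variable {F : Type*} [AddCommGroup F]

theorem wordSum_succ_zero (u v : F → F) (d : ℕ) (a : F) :
    wordSum u v (d + 1) 0 a = u (wordSum u v d 0 a) := by rw [wordSum]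

theorem wordSum_zero_succ (u v : F → F) (s : ℕ) (a : F) :
    wordSum u v 0 (s + 1) a = v (wordSum u v 0 s a) := by rw [wordSum]

theorem wordSum_succ_succ (u v : F → F) (d s : ℕ) (a : F) :
    wordSum u v (d + 1) (s + 1) a =
      u (wordSum u v d (s + 1) a) + v (wordSum u v (d + 1) s a) := by rw [wordSum]

theorem wordSum_zero {u v : F → F} (hu : u 0 = 0) (hv : v 0 = 0) (d s : ℕ) :
    wordSum u v d s 0 = 0 := by
  -- Functional induction needs a variable in place of `0`.
  suffices h : ∀ a, a = 0 → wordSum u v d s a = a from h 0 rfl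
  intro a ha
  fun_induction wordSum u v d s a <;> simp_all

/-- The expansion of words of length `k + 1` by their outermost letter. -/
theorem sum_wordSum_succ {M : Type*} [AddCommGroup M] (u v : F → F) (φ : ℕ → F →+ M) (k : ℕ)
    (a : F) :
    ∑ i ∈ Finset.range (k + 2), φ i (wordSum u v (k + 1 - i) i a) =
      ∑ i ∈ Finset.range (k + 1), (φ (i + 1) (v (wordSum u v (k - i) i a)) +
        φ i (u (wordSum u v (k - i) i a))) := by
  rw [Finset.sum_add_distrib]
  have h : ∀ i ∈ Finset.range k, φ (i + 1) (wordSum u v (k + 1 - (i + 1)) (i + 1) a) =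
      φ (i + 1) (v (wordSum u v (k - i) i a)) +
        φ (i + 1) (u (wordSum u v (k - (i + 1)) (i + 1) a)) := by
    intro i hi
    obtain ⟨d, rfl⟩ := Nat.exists_eq_add_of_lt (Finset.mem_range.1 hi)
    rw [show i + d + 1 + 1 - (i + 1) = d + 1 by omega, show i + d + 1 - i = d + 1 by omega,
      show i + d + 1 - (i + 1) = d by omega, wordSum_succ_succ, map_add, add_comm]
  -- The extreme terms `i = 0` and `i = k + 1` are split off: their words use a single letter, so
  -- the recursion there has one summand instead of two.
  rw [Finset.sum_range_succ', Finset.sum_range_succ _ k, Finset.sum_congr rfl h,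
    Finset.sum_add_distrib, Finset.sum_range_succ _ k, Finset.sum_range_succ' (fun i => φ i (u _)) k]
  simp only [Nat.sub_self, Nat.sub_zero, wordSum_zero_succ, wordSum_succ_zero]
  abel

end WordSum

namespace SkewPoly

variable {F : Type*} [DivisionRing F] {σ : F ≃+* F} {δ : SigmaDerivation σ}

/-! ### Products of powers of `x` and constants -/

/-- Moving one more `x` past a coefficient applies `σ` or `δ` to it, that is, adds an outermost
letter to each word. -/
theorem X_pow_mul_C (k : ℕ) (b : F) :
    (X : SkewPoly σ δ) ^ k * C b =
      ∑ i ∈ Finset.range (k + 1), C (wordC σ δ (k - i) i b) * X ^ i := by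
  induction k with
  | zero => simp [wordC, wordSum]
  | succ k ih =>
    have := sum_wordSum_succ (fun b => δ b) (fun b => σ b)
      (fun i => (AddMonoidHom.mulRight ((X : SkewPoly σ δ) ^ i)).comp
        (CHom σ δ).toAddMonoidHom) k b
    refine Eq.trans ?_ this.symm
    rw [pow_succ', mul_assoc, ih, Finset.mul_sum]
    refine Finset.sum_congr rfl fun i _ => ?_
    rw [← mul_assoc, X_mul_C, add_mul, mul_assoc, ← pow_succ']
    rfl

/-- Moving `x` to the left applies `σ⁻¹` or `-δσ⁻¹`. The sign counts the `k - i` letters `δσ⁻¹`, and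
`k + i` has the same parity. -/
theorem C_mul_X_pow_eq_sum (k : ℕ) (b : F) :
    C b * (X : SkewPoly σ δ) ^ k =
      ∑ i ∈ Finset.range (k + 1),
        (X : SkewPoly σ δ) ^ i * C ((-1) ^ (k + i) * wordT σ δ (k - i) i b) := by
  induction k with
  | zero => simp [wordT, wordSum, mul_one, one_mul]
  | succ k ih =>
    have := sum_wordSum_succ (fun b => δ (σ.symm b)) (fun b => σ.symm b)
      (fun i => (AddMonoidHom.mulLeft ((X : SkewPoly σ δ) ^ i)).comp
        ((CHom σ δ).toAddMonoidHom.comp (AddMonoidHom.mulLeft ((-1) ^ (k + 1 + i))))) k b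
    refine Eq.trans ?_ this.symm
    rw [pow_succ, ← mul_assoc, ih, Finset.sum_mul]
    refine Finset.sum_congr rfl fun i _ => ?_
    have hs : (-1 : F) ^ (k + 1 + (i + 1)) = (-1) ^ (k + i) := by
      rw [show k + 1 + (i + 1) = k + i + 2 by omega, pow_add]; simp
    have hs' : (-1 : F) ^ (k + 1 + i) = -(-1) ^ (k + i) := by
      rw [show k + 1 + i = k + i + 1 by omega, pow_succ]; simp
    have hsign : ∀ c : F, C ((-1) ^ (k + i) * c) = ((-1) ^ (k + i) : SkewPoly σ δ) * C c := by
      intro c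
      rw [C_mul]
      congr 1
      have := map_pow (CHom σ δ) (-1) (k + i)
      rwa [map_neg, map_one] at this
    change X ^ i * C ((-1) ^ (k + i) * wordT σ δ (k - i) i b) * X =
      X ^ (i + 1) * C ((-1) ^ (k + 1 + (i + 1)) * σ.symm (wordT σ δ (k - i) i b)) +
        X ^ i * C ((-1) ^ (k + 1 + i) * δ (σ.symm (wordT σ δ (k - i) i b)))
    have hcomm : X * ((-1) ^ (k + i) : SkewPoly σ δ) = (-1) ^ (k + i) * X :=
      ((Commute.neg_one_right X).pow_right _).eq
    rw [hs, hs', neg_mul, C_neg, hsign, hsign, hsign, mul_assoc, mul_assoc, C_mul_X, pow_succ,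
      mul_assoc, ← mul_assoc X _ (C _), hcomm, mul_neg, ← sub_eq_add_neg, ← mul_sub, mul_assoc,
      ← mul_sub]

/-- The right coefficients of a polynomial. -/
theorem sum_X_pow_mul_C_rcoeff {f : SkewPoly σ δ} {n : ℕ} (h : ∀ i, n ≤ i → f.coeff i = 0) :
    ∑ i ∈ Finset.range n, X ^ i * C (f.rcoeff i) = f := by
  have hwT : ∀ d s, wordT σ δ d s 0 = 0 := fun d s =>
    wordSum_zero (by simp) (by simp) d s
  -- The sum is reindexed by `k = j + i` and cut off at `n` instead of the degree; the terms gained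
  -- or lost have zero coefficients. A summation range independent of `i` then allows the two sums
  -- to be exchanged.
  have hr : ∀ i, i < n → f.rcoeff i = ∑ k ∈ Finset.range n,
      if i < k + 1 then (-1) ^ (k + i) * wordT σ δ (k - i) i (f.coeff k) else 0 := by
    intro i hi
    rw [rcoeff]
    have h1 : ∑ j ∈ Finset.range (f.natDegree - i + 1),
        (-1) ^ j * wordT σ δ j i (f.coeff (j + i)) =
        ∑ j ∈ Finset.range (n - i), (-1) ^ j * wordT σ δ j i (f.coeff (j + i)) := by
      rcases le_total (f.natDegree - i + 1) (n - i) with hle | hle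
      · refine Finset.sum_subset (Finset.range_mono hle) fun j _ hj => ?_
        rw [Finset.mem_range] at hj
        rw [coeff_eq_zero_of_natDegree_lt (by omega), hwT, mul_zero]
      · refine (Finset.sum_subset (Finset.range_mono hle) fun j _ hj => ?_).symm
        rw [Finset.mem_range] at hj
        rw [h _ (by omega), hwT, mul_zero]
    rw [h1]
    obtain ⟨d, rfl⟩ := Nat.exists_eq_add_of_le hi.le
    symm
    rw [Finset.sum_range_add, Finset.sum_eq_zero, zero_add, Nat.add_sub_cancel_left]
    · refine Finset.sum_congr rfl fun j _ => ?_
      rw [if_pos (by omega), Nat.add_sub_cancel_left, add_comm i j, add_assoc, pow_add _ j, ← two_mul,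
        pow_mul]
      simp
    · intro k hk
      rw [Finset.mem_range] at hk
      rw [if_neg (by omega)]
  conv_rhs => rw [← sum_C_mul_X_pow h]
  simp only [C_mul_X_pow_eq_sum]
  rw [Finset.sum_congr rfl fun i hi => by rw [hr i (Finset.mem_range.1 hi), C_sum, Finset.mul_sum],
    Finset.sum_comm]
  refine Finset.sum_congr rfl fun k hk => ?_
  rw [Finset.mem_range] at hk
  symm
  refine Finset.sum_subset_zero_on_sdiff (Finset.range_mono hk) (fun i hi => ?_) fun i hi => ?_
  · rw [Finset.mem_sdiff, Finset.mem_range, Finset.mem_range] at hi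
    rw [if_neg hi.2, C_zero, mul_zero]
  · rw [if_pos (Finset.mem_range.1 hi)]

theorem coeff_X_pow_mul_C_of_lt (i : ℕ) (b : F) {j : ℕ} (h : i < j) :
    (X ^ i * C b : SkewPoly σ δ).coeff j = 0 :=
  coeff_X_pow_mul_of_lt (n := 0) (fun k hk => by rw [coeff_C, if_neg hk.ne']) i j h

/-- The term `x ^ i b_i` has degree at most `i`, and its coefficient at `x ^ i` is `σ ^ i (b_i)`, so
the coefficients vanish from the top down. -/
theorem eq_zero_of_sum_X_pow_mul_C_eq_zero (n : ℕ) (b : ℕ → F)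
    (h : ∑ i ∈ Finset.range n, (X : SkewPoly σ δ) ^ i * C (b i) = 0) : ∀ i < n, b i = 0 := by
  induction n with
  | zero => exact fun i hi => absurd hi (Nat.not_lt_zero i)
  | succ n ih =>
    have hn : b n = 0 := by
      have h1 := congrArg (fun f => coeff f n) h
      simp only [coeff_sum, coeff_zero] at h1
      rw [Finset.sum_range_succ, Finset.sum_eq_zero, zero_add] at h1
      · have h2 := coeff_X_pow_mul_add (σ := σ) (δ := δ) (g := C (b n)) (n := 0)
          (fun k hk => by rw [coeff_C, if_neg hk.ne']) n
        rw [add_zero, h1, coeff_C_zero] at h2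
        exact (map_eq_zero_iff _ (RingEquiv.injective _)).1 h2.symm
      · intro i hi
        exact coeff_X_pow_mul_C_of_lt i _ (Finset.mem_range.1 hi)
    rw [Finset.sum_range_succ, hn, C_zero, mul_zero, add_zero] at h
    intro i hi
    rcases Nat.lt_succ_iff_lt_or_eq.1 hi with hi | rfl
    · exact ih h i hi
    · exact hn

/-! ### Entries of the Sylvester matrices -/

/-- Substituting `l = i + j` separates the two indices; `N > k + m` leaves no nonzero term out of
range. -/
theorem sum_range_antidiagonal {M : Type*} [AddCommGroup M] (k m N : ℕ) (hN : k + m < N)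
    (φ : ℕ → ℕ → M) (hφ : ∀ i j, m < j → φ i j = 0) :
    ∑ l ∈ Finset.range N, ∑ i ∈ Finset.range (k + 1), (if i ≤ l then φ i (l - i) else 0) =
      ∑ j ∈ Finset.range (m + 1), ∑ i ∈ Finset.range (k + 1), φ i j := by
  rw [Finset.sum_comm, Finset.sum_comm (s := Finset.range (m + 1))]
  refine Finset.sum_congr rfl fun i hi => ?_
  rw [Finset.mem_range] at hi
  obtain ⟨d, rfl⟩ := Nat.exists_eq_add_of_le (show i + (m + 1) ≤ N by omega)
  rw [add_assoc, Finset.sum_range_add, Finset.sum_eq_zero, zero_add, Finset.sum_range_add,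
    add_eq_left.2]
  · exact Finset.sum_congr rfl fun j _ => by
      rw [if_pos (by omega), Nat.add_sub_cancel_left]
  · exact Finset.sum_eq_zero fun j _ => by
      rw [if_pos (by omega), hφ _ _ (by omega)]
  · intro l hl
    rw [Finset.mem_range] at hl
    rw [if_neg (by omega)]

theorem sum_sylvEntry (f : SkewPoly σ δ) {k N : ℕ} (hN : k + f.natDegree < N) :
    ∑ l ∈ Finset.range N, C (sylvEntry f k l) * X ^ l = X ^ k * f := by
  have h := sum_range_antidiagonal k f.natDegree N hN
    (fun i j => (C (wordC σ δ (k - i) i (f.coeff j)) * X ^ (i + j) : SkewPoly σ δ))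
    (fun i j hj => by
      rw [coeff_eq_zero_of_natDegree_lt hj, wordC, wordSum_zero (map_zero _) (map_zero _), C_zero,
        zero_mul])
  conv_rhs => rw [← sum_range_natDegree f]
  simp only [Finset.mul_sum, ← mul_assoc, X_pow_mul_C, Finset.sum_mul]
  simp only [mul_assoc, ← pow_add]
  rw [← h]
  refine Finset.sum_congr rfl fun l _ => ?_
  rw [sylvEntry, C_sum, Finset.sum_mul]
  refine Finset.sum_congr rfl fun i _ => ?_
  split_ifs with hil
  · rw [Nat.add_sub_cancel' hil]
  · rw [C_zero, zero_mul]

theorem rcoeff_eq_zero_of_natDegree_lt {f : SkewPoly σ δ} {i : ℕ} (h : f.natDegree < i) :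
    f.rcoeff i = 0 :=
  Finset.sum_eq_zero fun j _ => by
    rw [coeff_eq_zero_of_natDegree_lt (by omega), wordT, wordSum_zero (by simp) (by simp), mul_zero]

theorem sum_sylvEntryL (f : SkewPoly σ δ) {k N : ℕ} (hN : k + f.natDegree < N) :
    ∑ l ∈ Finset.range N, (X : SkewPoly σ δ) ^ l * C (sylvEntryL f k l) = f * X ^ k := by
  have h := sum_range_antidiagonal k f.natDegree N hN
    (fun i j => (X ^ (j + i) * C ((-1) ^ (k + i) * wordT σ δ (k - i) i (f.rcoeff j)) :
      SkewPoly σ δ))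
    (fun i j hj => by
      rw [rcoeff_eq_zero_of_natDegree_lt hj, wordT, wordSum_zero (by simp) (by simp), mul_zero,
        C_zero, mul_zero])
  conv_rhs => rw [← sum_X_pow_mul_C_rcoeff (f := f) (n := f.natDegree + 1)
    (fun i hi => coeff_eq_zero_of_natDegree_lt hi)]
  simp only [Finset.sum_mul, mul_assoc, C_mul_X_pow_eq_sum, Finset.mul_sum]
  simp only [← mul_assoc, ← pow_add]
  rw [← h]
  refine Finset.sum_congr rfl fun l _ => ?_
  rw [sylvEntryL, C_sum, Finset.mul_sum]
  refine Finset.sum_congr rfl fun i _ => ?_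
  split_ifs with hil
  · rw [Nat.sub_add_cancel hil]
  · rw [C_zero, mul_zero]

/-! ### Vanishing of the resultants -/

theorem coeff_sum_fin_C_mul_X_pow {n : ℕ} (v : Fin n → F) (j : ℕ) :
    (∑ k : Fin n, C (v k) * (X : SkewPoly σ δ) ^ (k : ℕ)).coeff j =
      if h : j < n then v ⟨j, h⟩ else 0 := by
  simp only [coeff_sum, C_mul_X_pow_coeff]
  split_ifs with h
  · rw [Finset.sum_eq_single ⟨j, h⟩ (fun k _ hk => if_neg fun h' => hk (Fin.ext h'))
      (fun h' => absurd (Finset.mem_univ _) h'), if_pos rfl]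
  · exact Finset.sum_eq_zero fun k _ => if_neg (by omega)

theorem sum_fin_C_mul_X_pow_eq_zero {n : ℕ} {v : Fin n → F}
    (h : ∑ k : Fin n, C (v k) * (X : SkewPoly σ δ) ^ (k : ℕ) = 0) (k : Fin n) : v k = 0 := by
  have := coeff_sum_fin_C_mul_X_pow (σ := σ) (δ := δ) v k
  rw [h, dif_pos k.2] at this
  exact this.symm

theorem sum_fin_X_pow_mul_C_eq_zero {n : ℕ} {v : Fin n → F}
    (h : ∑ k : Fin n, (X : SkewPoly σ δ) ^ (k : ℕ) * C (v k) = 0) (k : Fin n) : v k = 0 := by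
  have := eq_zero_of_sum_X_pow_mul_C_eq_zero (σ := σ) (δ := δ) n
    (fun i => if h : i < n then v ⟨i, h⟩ else 0)
    (by rw [Finset.sum_range]; simpa using h) k k.2
  simpa using this

/-- Row `k` of each block holds the coefficients of `x ^ k f` or `x ^ k g`, so the row vector `v A`,
read as a polynomial, is `c f + d g`. -/
theorem sum_vecMul_sylvester (f g : SkewPoly σ δ) (v : Fin (g.natDegree + f.natDegree) → F) :
    ∑ l : Fin (g.natDegree + f.natDegree), C (∑ p, v p * sylvester f g p l) * X ^ (l : ℕ) =
      (∑ k : Fin g.natDegree, C (v (Fin.castAdd _ k)) * X ^ (k : ℕ)) * f +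
        (∑ k : Fin f.natDegree, C (v (Fin.natAdd _ k)) * X ^ (k : ℕ)) * g := by
  simp only [C_sum, Finset.sum_mul, C_mul]
  rw [Finset.sum_comm, Fin.sum_univ_add]
  simp only [mul_assoc, ← Finset.mul_sum, sylvester, Matrix.of_apply, Fin.addCases_left,
    Fin.addCases_right]
  congr 1 <;> refine Finset.sum_congr rfl fun k _ => ?_
  · rw [← sum_sylvEntry f (show k + f.natDegree < g.natDegree + f.natDegree by omega),
      Finset.sum_range]
  · rw [← sum_sylvEntry g (show k + g.natDegree < g.natDegree + f.natDegree by omega),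
      Finset.sum_range]

/-- The columns hold the right-hand coefficients of `f x ^ k` and `g x ^ k`, so `M v` is `f c + g
d`. -/
theorem sum_mulVec_sylvesterL (f g : SkewPoly σ δ) (v : Fin (g.natDegree + f.natDegree) → F) :
    ∑ l : Fin (g.natDegree + f.natDegree), X ^ (l : ℕ) * C (∑ p, sylvesterL f g l p * v p) =
      f * (∑ k : Fin g.natDegree, X ^ (k : ℕ) * C (v (Fin.castAdd _ k))) +
        g * (∑ k : Fin f.natDegree, X ^ (k : ℕ) * C (v (Fin.natAdd _ k))) := by
  simp only [C_sum, Finset.mul_sum, C_mul]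
  rw [Finset.sum_comm, Fin.sum_univ_add]
  simp only [← mul_assoc, ← Finset.sum_mul, sylvesterL, Matrix.of_apply, Fin.addCases_left,
    Fin.addCases_right]
  congr 1 <;> refine Finset.sum_congr rfl fun k _ => ?_
  · rw [← sum_sylvEntryL f (show k + f.natDegree < g.natDegree + f.natDegree by omega),
      Finset.sum_range]
  · rw [← sum_sylvEntryL g (show k + g.natDegree < g.natDegree + f.natDegree by omega),
      Finset.sum_range]

theorem resultant_eq_zero_iff (f g : SkewPoly σ δ) :
    resultant f g = 0 ↔ ∃ c d : SkewPoly σ δ, (c ≠ 0 ∨ d ≠ 0) ∧ c.degree < g.natDegree ∧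
      d.degree < f.natDegree ∧ c * f + d * g = 0 := by
  rw [resultant, Ddet_eq_zero_iff_exists_vecMul]
  constructor
  · rintro ⟨v, hv, h⟩
    refine ⟨∑ k : Fin g.natDegree, C (v (Fin.castAdd _ k)) * X ^ (k : ℕ),
      ∑ k : Fin f.natDegree, C (v (Fin.natAdd _ k)) * X ^ (k : ℕ), ?_, ?_, ?_, ?_⟩
    · by_contra! h0
      refine hv (funext fun p => ?_)
      refine Fin.addCases (fun k => ?_) (fun k => ?_) p
      · exact sum_fin_C_mul_X_pow_eq_zero h0.1 k
      · exact sum_fin_C_mul_X_pow_eq_zero h0.2 k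
    · exact degree_lt_iff.2 fun i hi => by
        rw [coeff_sum_fin_C_mul_X_pow, dif_neg (by omega)]
    · exact degree_lt_iff.2 fun i hi => by
        rw [coeff_sum_fin_C_mul_X_pow, dif_neg (by omega)]
    · rw [← sum_vecMul_sylvester]
      exact Finset.sum_eq_zero fun l _ => by rw [h l, C_zero, zero_mul]
  · rintro ⟨c, d, hcd, hc, hd, h⟩
    let v : Fin (g.natDegree + f.natDegree) → F :=
      Fin.addCases (fun k => c.coeff k) (fun k => d.coeff k)
    have hc' := sum_C_mul_X_pow (degree_lt_iff.1 hc)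
    have hd' := sum_C_mul_X_pow (degree_lt_iff.1 hd)
    rw [Finset.sum_range] at hc' hd'
    refine ⟨v, fun h0 => ?_, ?_⟩
    · have h0c : ∀ k, c.coeff (k : Fin g.natDegree) = 0 := fun k => by
        simpa [v] using congrFun h0 (Fin.castAdd _ k)
      have h0d : ∀ k, d.coeff (k : Fin f.natDegree) = 0 := fun k => by
        simpa [v] using congrFun h0 (Fin.natAdd _ k)
      simp only [h0c, h0d, C_zero, zero_mul, Finset.sum_const_zero] at hc' hd'
      exact hcd.elim (fun h => h hc'.symm) fun h => h hd'.symm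
    · have := sum_vecMul_sylvester f g v
      simp only [v, Fin.addCases_left, Fin.addCases_right] at this
      rw [hc', hd', h] at this
      exact sum_fin_C_mul_X_pow_eq_zero this

theorem resultantL_eq_zero_iff (f g : SkewPoly σ δ) :
    resultantL f g = 0 ↔ ∃ c d : SkewPoly σ δ, (c ≠ 0 ∨ d ≠ 0) ∧ c.degree < g.natDegree ∧
      d.degree < f.natDegree ∧ f * c + g * d = 0 := by
  have hdeg : ∀ (n : ℕ) (v : Fin n → F),
      (∑ k : Fin n, (X : SkewPoly σ δ) ^ (k : ℕ) * C (v k)).degree < (n : WithBot ℕ) := fun n v =>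
    degree_lt_iff.2 fun i hi => by
      rw [coeff_sum]
      exact Finset.sum_eq_zero fun k _ => coeff_X_pow_mul_C_of_lt _ _ (by omega)
  rw [resultantL, Ddet_eq_zero_iff_exists_mulVec]
  constructor
  · rintro ⟨v, hv, h⟩
    -- The two polynomials are read off from the degree bounds supplied by `hdeg`.
    refine ⟨_, _, ?_, hdeg _ fun k => v (Fin.castAdd _ k), hdeg _ fun k => v (Fin.natAdd _ k), ?_⟩
    · by_contra! h0
      refine hv (funext fun p => ?_)
      refine Fin.addCases (fun k => ?_) (fun k => ?_) p
      · exact sum_fin_X_pow_mul_C_eq_zero h0.1 k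
      · exact sum_fin_X_pow_mul_C_eq_zero h0.2 k
    · rw [← sum_mulVec_sylvesterL]
      exact Finset.sum_eq_zero fun l _ => by rw [h l, C_zero, mul_zero]
  · rintro ⟨c, d, hcd, hc, hd, h⟩
    -- The unknowns of the left system are the right-hand coefficients, hence `rcoeff` and not
    -- `coeff`.
    let v : Fin (g.natDegree + f.natDegree) → F :=
      Fin.addCases (fun k => c.rcoeff k) (fun k => d.rcoeff k)
    have hc' := sum_X_pow_mul_C_rcoeff (degree_lt_iff.1 hc)
    have hd' := sum_X_pow_mul_C_rcoeff (degree_lt_iff.1 hd)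
    rw [Finset.sum_range] at hc' hd'
    refine ⟨v, fun h0 => ?_, ?_⟩
    · have h0c : ∀ k, c.rcoeff (k : Fin g.natDegree) = 0 := fun k => by
        simpa [v] using congrFun h0 (Fin.castAdd _ k)
      have h0d : ∀ k, d.rcoeff (k : Fin f.natDegree) = 0 := fun k => by
        simpa [v] using congrFun h0 (Fin.natAdd _ k)
      simp only [h0c, h0d, C_zero, mul_zero, Finset.sum_const_zero] at hc' hd'
      exact hcd.elim (fun h => h hc'.symm) fun h => h hd'.symm
    · have := sum_mulVec_sylvesterL f g v
      simp only [v, Fin.addCases_left, Fin.addCases_right] at this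
      rw [hc', hd', h] at this
      exact sum_fin_X_pow_mul_C_eq_zero this

theorem natDegree_lt_of_degree_lt {f : SkewPoly σ δ} {n : ℕ} (hf : f ≠ 0) (h : f.degree < n) :
    f.natDegree < n := by
  rwa [degree_eq_natDegree hf, Nat.cast_lt] at h

/-- A relation `c f + d g = 0` becomes `(c (x - a) + d) g = -c e`. If `e ≠ 0` and `c ≠ 0`, the left
side has degree at least `deg g`, the right side `deg c < deg g`. So `e ≠ 0` forces `c = 0`, and
then `d = 0`. -/
theorem resultant_eq_zero_iff_of_eq_X_sub_C_mul_add {f g : SkewPoly σ δ} {a e : F}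
    (h : f = (X - C a) * g + C e) (hfg : f.natDegree = g.natDegree + 1) (hg : 0 < g.natDegree) :
    resultant f g = 0 ↔ e = 0 := by
  have hg0 : g ≠ 0 := fun h => by rw [h, ← C_zero, natDegree_C] at hg; exact hg.false
  rw [resultant_eq_zero_iff]
  constructor
  · rintro ⟨c, d, hcd, hc, -, hz⟩
    by_contra he
    have hCe : (C e : SkewPoly σ δ) ≠ 0 := mt C_eq_zero.1 he
    have h1 : (c * (X - C a) + d) * g = -(c * C e) := by
      rw [add_mul, mul_assoc, eq_neg_iff_add_eq_zero, add_right_comm, ← mul_add, ← h, hz]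
    have hc0 : c = 0 := by
      by_contra hc0
      have h2 : (-c) * C e = -(c * C e) := neg_mul _ _
      have h3 : (-c).natDegree = c.natDegree := natDegree_eq
        (fun i hi => by rw [coeff_neg, coeff_eq_zero_of_natDegree_lt hi, neg_zero])
        (by rw [coeff_neg]; exact neg_ne_zero.2 (coeff_natDegree_ne_zero hc0))
      have h4 := natDegree_mul (neg_ne_zero.2 hc0) hCe
      have hne : c * (X - C a) + d ≠ 0 := fun h0 => by
        rw [h0, zero_mul, ← h2, eq_comm, mul_eq_zero] at h1
        exact h1.elim (neg_ne_zero.2 hc0) hCe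
      have h5 := natDegree_mul hne hg0
      have h6 := natDegree_lt_of_degree_lt hc0 hc
      rw [h1, ← h2, h4, h3, natDegree_C] at h5
      omega
    rw [hc0, zero_mul, zero_mul, zero_add, neg_zero, mul_eq_zero] at h1
    exact hcd.elim (fun h => h hc0) fun h => h (h1.resolve_right hg0)
  · rintro rfl
    rw [C_zero, add_zero] at h
    -- The relation is `f - (x - a) g = 0`; the degree bounds hold since `deg g ≥ 1` and `deg f ≥
    -- 2`.
    refine ⟨1, -(X - C a), .inl one_ne_zero, degree_lt_iff.2 fun i hi => ?_,
      degree_lt_iff.2 fun i hi => ?_, by rw [one_mul, neg_mul, ← h, add_neg_cancel]⟩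
    · rw [← C_one, coeff_C, if_neg (by omega)]
    · rw [coeff_neg, coeff_eq_zero_of_natDegree_lt (by rw [natDegree_X_sub_C]; omega), neg_zero]

theorem resultantL_eq_zero_iff_of_eq_mul_X_sub_C_add {f g : SkewPoly σ δ} {a e : F}
    (h : f = g * (X - C a) + C e) (hfg : f.natDegree = g.natDegree + 1) (hg : 0 < g.natDegree) :
    resultantL f g = 0 ↔ e = 0 := by
  have hg0 : g ≠ 0 := fun h => by rw [h, ← C_zero, natDegree_C] at hg; exact hg.false
  rw [resultantL_eq_zero_iff]
  constructor
  · rintro ⟨c, d, hcd, hc, -, hz⟩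
    by_contra he
    have hCe : (C e : SkewPoly σ δ) ≠ 0 := mt C_eq_zero.1 he
    have h1 : g * ((X - C a) * c + d) = -(C e * c) := by
      rw [mul_add, ← mul_assoc, eq_neg_iff_add_eq_zero, add_right_comm, ← add_mul, ← h, hz]
    have hc0 : c = 0 := by
      by_contra hc0
      have h2 : C e * (-c) = -(C e * c) := mul_neg _ _
      have h3 : (-c).natDegree = c.natDegree := natDegree_eq
        (fun i hi => by rw [coeff_neg, coeff_eq_zero_of_natDegree_lt hi, neg_zero])
        (by rw [coeff_neg]; exact neg_ne_zero.2 (coeff_natDegree_ne_zero hc0))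
      have h4 := natDegree_mul hCe (neg_ne_zero.2 hc0)
      have hne : (X - C a) * c + d ≠ 0 := fun h0 => by
        rw [h0, mul_zero, ← h2, eq_comm, mul_eq_zero] at h1
        exact h1.elim hCe (neg_ne_zero.2 hc0)
      have h5 := natDegree_mul hg0 hne
      have h6 := natDegree_lt_of_degree_lt hc0 hc
      rw [h1, ← h2, h4, h3, natDegree_C] at h5
      omega
    rw [hc0, mul_zero, mul_zero, zero_add, neg_zero, mul_eq_zero] at h1
    exact hcd.elim (fun h => h hc0) fun h => h (h1.resolve_left hg0)
  · rintro rfl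
    rw [C_zero, add_zero] at h
    refine ⟨1, -(X - C a), .inl one_ne_zero, degree_lt_iff.2 fun i hi => ?_,
      degree_lt_iff.2 fun i hi => ?_, by rw [mul_one, mul_neg, ← h, add_neg_cancel]⟩
    · rw [← C_one, coeff_C, if_neg (by omega)]
    · rw [coeff_neg, coeff_eq_zero_of_natDegree_lt (by rw [natDegree_X_sub_C]; omega), neg_zero]

end SkewPoly

end

/-! ### The main theorem. -/

theorem theorem3p45 {F : Type*} [DivisionRing F] (σ : F ≃+* F) (δ : SigmaDerivation σ)
    (f : SkewPoly σ δ) (a : F) (r : ℕ) (hr : 0 < r) (hrf : r < f.natDegree) :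
    List.TFAE [
      f.IsRightRootOfMultGE a r,
      ∀ j < r, (SkewPoly.rightDer a j f).IsRightRoot a,
      ∀ j < r, SkewPoly.resultantL (SkewPoly.rightDer a j f) (SkewPoly.rightDer a (j + 1) f) = 0,
      ∀ j < r, SkewPoly.gcld (SkewPoly.rightDer a j f) (SkewPoly.rightDer a (j + 1) f) ≠ 1] ∧
    List.TFAE [
      f.IsLeftRootOfMultGE a r,
      ∀ j < r, (SkewPoly.leftDer a j f).IsLeftRoot a,
      ∀ j < r, SkewPoly.resultant (SkewPoly.leftDer a j f) (SkewPoly.leftDer a (j + 1) f) = 0,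
      ∀ j < r, SkewPoly.gcrd (SkewPoly.leftDer a j f) (SkewPoly.leftDer a (j + 1) f) ≠ 1] := by
  constructor
  -- Since `r < deg f`, all derivative polynomials up to order `r` have positive degree, as the gcd
  -- and resultant criteria require.
  · have hdeg : ∀ j ≤ r, (SkewPoly.rightDer a j f).natDegree = f.natDegree - j := fun j hj =>
      SkewPoly.natDegree_rightDer f a (by omega)
    tfae_have 1 ↔ 2 := SkewPoly.isRightRootOfMultGE_iff f a r
    tfae_have 3 ↔ 2 := forall₂_congr fun j hj =>
      SkewPoly.resultantL_eq_zero_iff_of_eq_mul_X_sub_C_add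
        (SkewPoly.rightDer_eq_rightDer_succ_mul_add f a j)
        (by rw [hdeg j hj.le, hdeg (j + 1) hj]; omega) (by rw [hdeg (j + 1) hj]; omega)
    tfae_have 4 ↔ 2 := forall₂_congr fun j hj =>
      SkewPoly.gcld_ne_one_iff (SkewPoly.rightDer_eq_rightDer_succ_mul_add f a j)
        (by rw [hdeg (j + 1) hj]; omega)
    tfae_finish
  · have hdeg : ∀ j ≤ r, (SkewPoly.leftDer a j f).natDegree = f.natDegree - j := fun j hj =>
      SkewPoly.natDegree_leftDer f a (by omega)
    tfae_have 1 ↔ 2 := SkewPoly.isLeftRootOfMultGE_iff f a r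
    tfae_have 3 ↔ 2 := forall₂_congr fun j hj =>
      SkewPoly.resultant_eq_zero_iff_of_eq_X_sub_C_mul_add
        (SkewPoly.leftDer_eq_mul_leftDer_succ_add f a j)
        (by rw [hdeg j hj.le, hdeg (j + 1) hj]; omega) (by rw [hdeg (j + 1) hj]; omega)
    tfae_have 4 ↔ 2 := forall₂_congr fun j hj =>
      SkewPoly.gcrd_ne_one_iff (SkewPoly.leftDer_eq_mul_leftDer_succ_add f a j)
        (by rw [hdeg (j + 1) hj]; omega)
    tfae_finish
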